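/- **Setting.** Let $r,k$ be integers with $0\le k\le r$, let $d\in\mathbb N$, and let $(\cdot,\cdot)$, $\|\cdot\|$ be the Euclidean inner product and norm of $\mathbb R^d$. $P_s$ denotes polynomials of degree at most $s$ ($P_{-1}=\{0\}$), and all scalar operators act component-wise on vector-valued functions. Let $\widehat{\mathscr I}$ be a linear functional on $C^{k_{\mathscr I}}([-1,1])$ (the integrator), and $\widehat{\mathcal I}$ a linear operator on $C^{k_{\mathcal I}}([-1,1])$ mapping $C^{\max\{k_{\mathcal I},l\}}([-1,1])$ into $C^l([-1,1])$ for every $l\ge 0$. Put $k_{\mathcal J}=\max\{\lfloor k/2\rfloor-1,k_{\mathscr I},k_{\mathcal I}\}$. For an interval $(a,b]$ with affine map $T_{a,b}:[-1,1]\to[a,b]$, $\hat t\mapsto\frac{a+b}2+\frac{b-a}2\hat t$, put $\mathscr I_{a,b}[\varphi]=\frac{b-a}{2}\widehat{\mathscr I}[\varphi\circ T_{a,b}]$ and $\mathcal I_{a,b}\psi=(\widehat{\mathcal I}(\psi\circ T_{a,b}))\circ T_{a,b}^{-1}$. Consider $u'(t)=f(t,u(t))$ on $[t_0,t_0+T]$,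 $u(t_0)=u_0\in\mathbb R^d$, $T>0$, where $f$ is $C^{k_{\mathcal J}}$ on $[t_0,t_0+T]\times\mathbb R^d$, and a mesh $t_0<t_1<\dots<t_N=t_0+T$ with $I_n=(t_{n-1},t_n]$, $\tau_n=t_n-t_{n-1}\le 1$, $\tau=\max_n\tau_n$. Write $\mathscr I_n,\mathcal I_n,T_n$ for the operators and the map on $I_n$. **Method.** $U$ is a discrete solution if, with $U(t_0^-)=u_0$, for each $n=1,\dots,N$ one has $U|_{I_n}\in P_r(I_n,\mathbb R^d)$ and - $U(t_{n-1}^+)=U(t_{n-1}^-)$ if $k\ge1$; - $U^{(i+1)}(t_n^-)=\frac{d^i}{dt^i}f(t,U(t))|_{t=t_n^-}$ for $0\le i\le\lfloor\frac k2\rfloor-1$ if $k\ge2$; - $U^{(i+1)}(t_{n-1}^+)=\frac{d^i}{dt^i}f(t,U(t))|_{t=t_{n-1}^+}$ for $0\le i\le\lfloor\frac{k-1}2\rfloor-1$ if $k\ge3$; - $\mathscr I_n[(U',\varphi)]+\delta_{0,k}\big(U(t_{n-1}^+)-U(t_{n-1}^-),\varphi(t_{n-1}^+)\big)=\mathscr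 I_n[(\mathcal I_nf(\cdot,U(\cdot)),\varphi)]$ for all $\varphi\in P_{r-k}(I_n,\mathbb R^d)$. **Approximation operator.** $\mathcal J_nv\in P_r(I_n,\mathbb R^d)$ is the polynomial with $(\mathcal J_nv)^{(i)}(t_{n-1}^+)=v^{(i)}(t_{n-1}^+)$ for $0\le i\le\lfloor\frac{k-1}2\rfloor$ if $k\ge1$, $(\mathcal J_nv)^{(i)}(t_n^-)=v^{(i)}(t_n^-)$ for $1\le i\le\lfloor\frac k2\rfloor$ if $k\ge2$, and $\mathscr I_n[((\mathcal J_nv)',\varphi)]+\delta_{0,k}(\mathcal J_nv(t_{n-1}^+),\varphi(t_{n-1}^+))=\mathscr I_n[(\mathcal I_n(v'),\varphi)]+\delta_{0,k}(v(t_{n-1}^+),\varphi(t_{n-1}^+))$ for all $\varphi\in P_{r-k}(I_n,\mathbb R^d)$. **Assumptions.** 1. If $\hat\psi\in P_{r-\max\{1,k\}}$ and $\widehat{\mathscr I}\big[(1-\hat t)^{\lfloor k/2\rfloor}(1+\hat t)^{|\lfloor (k-1)/2\rfloor|}\hat\psi\hat\varphi\big]=0$ for all $\hat\varphi\in P_{r-\max\{1,k\}}$,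 then $\hat\psi=0$. 2. There is $\mathfrak C_0$ with $\|\widehat{\mathscr I}[\hat\varphi]\|\le\mathfrak C_0\sum_{j=0}^{k_{\mathscr I}}\sup_{[-1,1]}\|\hat\varphi^{(j)}\|$ for all $\hat\varphi\in C^{k_{\mathscr I}}([-1,1],\mathbb R^d)$. 3. There are distinct points $\hat t_0,\dots,\hat t_K\in[-1,1]$ and integers $\kappa_0,\dots,\kappa_K\ge0$ such that (A) or (B) holds. For a function $\varphi$ on $[a,b]$ write $S_{a,b}(\varphi)=\sum_{m=0}^K\sum_{j=0}^{\kappa_m}\big(\tfrac{b-a}2\big)^j\|\varphi^{(j)}(T_{a,b}\hat t_m)\|$. - (A) $\kappa_m\le k_{\mathcal I}$ for all $m$, and there are constants $c_1,c_2$ such that for all $a<b$, $0\le l\le k_{\mathscr I}$ and $\varphi\in C^{k_{\mathcal I}}([a,b],\mathbb R^d)$: $\mathcal I_{a,b}\varphi\in C^l([a,b],\mathbb R^d)$ and $\big(\tfrac{b-a}2\big)^l\sup_{(a,b]}\|(\mathcal I_{a,b}\varphi)^{(l)}\|\le c_1S_{a,b}(\varphi)+c_2\sup_{(a,b]}\|\varphi\|$.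 - (B) $\kappa_m\le\max\{k_{\mathscr I},k_{\mathcal I}\}$ for all $m$, and there are distinct points $\hat s_0,\dots,\hat s_{K'}\in[-1,1]$, integers $0\le\lambda_m\le k_{\mathscr I}$ and constants $c_1,\dots,c_4$ such that, with $S'_{a,b}(\varphi)=\sum_{m=0}^{K'}\sum_{j=0}^{\lambda_m}\big(\tfrac{b-a}2\big)^j\|\varphi^{(j)}(T_{a,b}\hat s_m)\|$, for all $a<b$: $\|\mathscr I_{a,b}[\varphi]\|\le\tfrac{b-a}2\big(c_1S'_{a,b}(\varphi)+c_2\sup_{(a,b]}\|\varphi\|\big)$ for all $\varphi\in C^{k_{\mathscr I}}([a,b],\mathbb R^d)$, and $S'_{a,b}(\mathcal I_{a,b}\varphi)+\sup_{(a,b]}\|\mathcal I_{a,b}\varphi\|\le c_3S_{a,b}(\varphi)+c_4\sup_{(a,b]}\|\varphi\|$ for all $\varphi\in C^{\max\{k_{\mathscr I},k_{\mathcal I}\}}([a,b],\mathbb R^d)$. 4. $\mathfrak C_2\ge0$ satisfies, for $0\le i\le k_{\mathcal J}$ and all $v,w\in C^{k_{\mathcal J}+1}([t_0,t_0+T],\mathbb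 R^d)$, $\big\|\frac{d^i}{dt^i}\big(f(t,v(t))-f(t,w(t))\big)\big|_{t=s}\big\|\le\mathfrak C_2\sum_{l=0}^i\|(v-w)^{(l)}(s)\|$ for a.e. $s\in[t_0,t_0+T]$. **Interpolation operator.** $\mathcal I^{\mathrm{app}}_nv$ is the Hermite-type interpolation polynomial on $I_n$ that preserves the derivatives of $v$ of orders $0,\dots,\lfloor\frac k2\rfloor-1$ at $t_n^-$, of orders $0,\dots,\lfloor\frac{k-1}2\rfloor-1$ at $t_{n-1}^+$, and of orders $0,\dots,\kappa_m$ at $T_n\hat t_m$, $0\le m\le K$; if $r^{\mathrm{app}}$, the number of these conditions without repetition, is smaller than $r+1$, it also preserves the values at the images under $T_n$ of $r+1-r^{\mathrm{app}}$ further points, which are chosen (once for all $n$) in $(-1,1)\setminus\{\hat t_0,\dots,\hat t_K\}$. Its degree is at most $\max\{r^{\mathrm{app}}-1,r\}$. **Theorem.** Suppose that Assumptions 1, 2 and 3 hold and fix the further interpolation points. Then there is a constant $M>0$, depending only on these reference data ($d,r,k$, $\widehat{\mathscr I},\widehat{\mathcal I}$ and the points, orders and constants in Assumptions 2 and 3)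 but not on $t_0,T,f,\mathfrak C_2,u_0,u,U$ or the mesh, such that the following holds for all $t_0$, $T$, $f$, $\mathfrak C_2$, $u_0$ as above for which Assumption 4 holds, and all meshes as above that are sufficiently fine in the sense that $M\,\mathfrak C_2\,\tau\le1$. If $u$ is the solution of the initial value problem and $U$ a discrete solution, then for $1\le n\le N$ and $l=0,1$ $$\sup_{t\in I_n}\|(u-U)^{(l)}(t)\|\le C\max_{1\le\nu\le n}\Big(\sup_{t\in I_\nu}\|(u-\mathcal I^{\mathrm{app}}_\nu u)(t)\|+\sum_{j=0}^l\sup_{t\in I_\nu}\|(u-\mathcal J_\nu u)^{(j)}(t)\|\Big)+C\max_{1\le\nu\le n-1}\tau_\nu^{-1}\|(u-\mathcal J_\nu u)(t_\nu^-)\|$$ with $C=M(1+T)(1+\mathfrak C_2)\exp(M\,T\,\mathfrak C_2)$, where the last maximum is $0$ for $n=1$. -/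

import Mathlib

open Set MeasureTheory

noncomputable section

namespace VTD

/-- The state space `ℝ^d` with the Euclidean norm and the standard inner product. -/
abbrev E (d : ℕ) : Type := EuclideanSpace ℝ (Fin d)

/-! ### Reference operators on `[-1, 1]` -/

/-- A linear functional on `C^m([-1,1])`. A function on `[-1,1]` is represented by any extension
to `ℝ` (the value depends on the restriction to `[-1,1]` only); values at functions that are not
`C^m` on `[-1,1]` are irrelevant. -/
structure RefIntegrator (m : ℕ) where
  toFun : (ℝ → ℝ) → ℝ
  congr_on : ∀ v w : ℝ → ℝ, EqOn v w (Icc (-1) 1) → toFun v = toFun w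
  map_add : ∀ v w : ℝ → ℝ, ContDiffOn ℝ m v (Icc (-1) 1) → ContDiffOn ℝ m w (Icc (-1) 1) →
    toFun (fun x => v x + w x) = toFun v + toFun w
  map_smul : ∀ (c : ℝ) (v : ℝ → ℝ), ContDiffOn ℝ m v (Icc (-1) 1) →
    toFun (fun x => c * v x) = c * toFun v

/-- A linear operator on `C^m([-1,1])` that maps `C^{max(m,l)}([-1,1])` into `C^l([-1,1])` for
every `l`. Functions on `[-1,1]` are represented as in `RefIntegrator`. -/
structure RefApprox (m : ℕ) where
  toFun : (ℝ → ℝ) → ℝ → ℝ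
  congr_on : ∀ v w : ℝ → ℝ, EqOn v w (Icc (-1) 1) → EqOn (toFun v) (toFun w) (Icc (-1) 1)
  map_add : ∀ v w : ℝ → ℝ, ContDiffOn ℝ m v (Icc (-1) 1) → ContDiffOn ℝ m w (Icc (-1) 1) →
    EqOn (toFun (fun x => v x + w x)) (fun x => toFun v x + toFun w x) (Icc (-1) 1)
  map_smul : ∀ (c : ℝ) (v : ℝ → ℝ), ContDiffOn ℝ m v (Icc (-1) 1) →
    EqOn (toFun (fun x => c * v x)) (fun x => c * toFun v x) (Icc (-1) 1)
  smooth : ∀ (l : ℕ) (v : ℝ → ℝ), ContDiffOn ℝ (max m l : ℕ) v (Icc (-1) 1) →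
    ContDiffOn ℝ l (toFun v) (Icc (-1) 1)

/-! ### Local operators on an interval `[a, b]` -/

/-- The affine map of `[-1,1]` onto `[a,b]`. -/
def aff (a b x : ℝ) : ℝ := (b + a) / 2 + (b - a) / 2 * x

/-- The inverse of `aff a b`. -/
def affInv (a b t : ℝ) : ℝ := (2 * t - (b + a)) / (b - a)

/-- The local integrator on `[a,b]` (scalar functions). -/
def locInt {m : ℕ} (Q : RefIntegrator m) (a b : ℝ) (φ : ℝ → ℝ) : ℝ :=
  (b - a) / 2 * Q.toFun (fun x => φ (aff a b x))

/-- The local approximation operator on `[a,b]`, acting component-wise. -/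
def locApprox {m d : ℕ} (A : RefApprox m) (a b : ℝ) (ψ : ℝ → E d) : ℝ → E d :=
  fun t => WithLp.toLp 2 fun i => A.toFun (fun x => ψ (aff a b x) i) (affInv a b t)

/-- The reference integrator acting component-wise on vector-valued functions. -/
def vecRefInt {m d : ℕ} (Q : RefIntegrator m) (φ : ℝ → E d) : E d :=
  WithLp.toLp 2 fun i => Q.toFun fun x => φ x i

/-- The local integrator acting component-wise on vector-valued functions. -/
def vecLocInt {m d : ℕ} (Q : RefIntegrator m) (a b : ℝ) (φ : ℝ → E d) : E d :=
  WithLp.toLp 2 fun i => locInt Q a b fun t => φ t i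

/-- `sup_{t ∈ s} ‖g t‖`; only used for functions that are bounded on the nonempty set `s`. -/
def supNorm {d : ℕ} (s : Set ℝ) (g : ℝ → E d) : ℝ := ⨆ t : s, ‖g t‖

/-- `v` is a polynomial function with values in `ℝ^d`, of degree at most `s`. -/
def IsVecPoly {d : ℕ} (s : ℕ) (v : ℝ → E d) : Prop :=
  ∃ p : Fin d → Polynomial ℝ, (∀ i, (p i).natDegree ≤ s) ∧ ∀ t i, v t i = (p i).eval t

/-! ### Assumptions on the operators and on the right-hand side -/

/-- `k_J = max {⌊k/2⌋ - 1, k_𝓘, k_I}`. -/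
def kJ (k kI kA : ℕ) : ℕ := max (k / 2 - 1) (max kI kA)

/-- Unisolvence of the reference integrator. `Polynomial.degreeLT ℝ (s + 1)` is the space of
polynomials of degree at most `s`, which is `{0}` for `s = -1`. -/
def AssUnisolvent {kI : ℕ} (r k : ℕ) (Q : RefIntegrator kI) : Prop :=
  ∀ ψ ∈ Polynomial.degreeLT ℝ (r + 1 - max 1 k),
    (∀ φ ∈ Polynomial.degreeLT ℝ (r + 1 - max 1 k),
      Q.toFun (fun x => (1 - x) ^ (k / 2) * (1 + x) ^ (((k : ℤ) - 1) / 2).natAbs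
        * ψ.eval x * φ.eval x) = 0) → ψ = 0

/-- Boundedness of the reference integrator on `C^{k_𝓘}([-1,1], ℝ^d)`. -/
def AssBounded {kI : ℕ} (d : ℕ) (Q : RefIntegrator kI) : Prop :=
  ∃ C₀ : ℝ, ∀ φ : ℝ → E d, ContDiffOn ℝ kI φ (Icc (-1) 1) →
    ‖vecRefInt Q φ‖ ≤ C₀ * ∑ j ∈ Finset.range (kI + 1),
      supNorm (Icc (-1) 1) (iteratedDerivWithin j φ (Icc (-1) 1))

/-- `∑_m ∑_{j ≤ κ_m} ((b-a)/2)^j ‖φ^{(j)}(t_m)‖`, with `t_m` the image of `x_m` in `[a,b]`. -/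
def pointSum {d K : ℕ} (x : Fin (K + 1) → ℝ) (κ : Fin (K + 1) → ℕ) (a b : ℝ) (φ : ℝ → E d) : ℝ :=
  ∑ m, ∑ j ∈ Finset.range (κ m + 1),
    ((b - a) / 2) ^ j * ‖iteratedDerivWithin j φ (Icc a b) (aff a b (x m))‖

/-- First alternative: supremum norms of derivatives of the local approximation are controlled by
derivatives of `φ` in the points `x_m` and by the supremum norm of `φ`. -/
def AssPointA {kA : ℕ} (d kI : ℕ) (A : RefApprox kA)
    {K : ℕ} (x : Fin (K + 1) → ℝ) (κ : Fin (K + 1) → ℕ) : Prop :=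
  (∀ m, κ m ≤ kA) ∧
  ∃ C₁ C₂ : ℝ, ∀ a b : ℝ, a < b → ∀ l ≤ kI, ∀ φ : ℝ → E d, ContDiffOn ℝ kA φ (Icc a b) →
    ContDiffOn ℝ l (locApprox A a b φ) (Icc a b) ∧
    ((b - a) / 2) ^ l * supNorm (Ioc a b) (iteratedDerivWithin l (locApprox A a b φ) (Icc a b))
      ≤ C₁ * pointSum x κ a b φ + C₂ * supNorm (Ioc a b) φ

/-- Second alternative: the local integrator itself is controlled by derivatives in certain points
`y_m` and by the supremum norm, and the corresponding quantities of the local approximation of `φ`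
are controlled by derivatives of `φ` in the points `x_m` and by the supremum norm of `φ`. -/
def AssPointB {kI kA : ℕ} (d : ℕ) (Q : RefIntegrator kI) (A : RefApprox kA)
    {K : ℕ} (x : Fin (K + 1) → ℝ) (κ : Fin (K + 1) → ℕ) : Prop :=
  (∀ m, κ m ≤ max kI kA) ∧
  ∃ (K' : ℕ) (y : Fin (K' + 1) → ℝ) (lam : Fin (K' + 1) → ℕ),
    Function.Injective y ∧ (∀ m, y m ∈ Icc (-1 : ℝ) 1) ∧ (∀ m, lam m ≤ kI) ∧
    (∃ C₁ C₂ : ℝ, ∀ a b : ℝ, a < b → ∀ φ : ℝ → E d, ContDiffOn ℝ kI φ (Icc a b) →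
      ‖vecLocInt Q a b φ‖ ≤ C₁ * ((b - a) / 2) * pointSum y lam a b φ
        + C₂ * ((b - a) / 2) * supNorm (Ioc a b) φ) ∧
    ∃ C₁ C₂ : ℝ, ∀ a b : ℝ, a < b →
      ∀ φ : ℝ → E d, ContDiffOn ℝ (max kI kA : ℕ) φ (Icc a b) →
      pointSum y lam a b (locApprox A a b φ) + supNorm (Ioc a b) (locApprox A a b φ)
        ≤ C₁ * pointSum x κ a b φ + C₂ * supNorm (Ioc a b) φ

/-- Lipschitz-type condition on total time derivatives, up to order `q`, of `f` along smooth
curves, with constant `C₂`. -/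
def AssDiff {d : ℕ} (q : ℕ) (f : ℝ → E d → E d) (t₀ T C₂ : ℝ) : Prop :=
  ∀ i ≤ q, ∀ v w : ℝ → E d,
    ContDiffOn ℝ (q + 1 : ℕ) v (Icc t₀ (t₀ + T)) → ContDiffOn ℝ (q + 1 : ℕ) w (Icc t₀ (t₀ + T)) →
    ∀ᵐ s ∂(volume.restrict (Icc t₀ (t₀ + T))),
      ‖iteratedDerivWithin i (fun t => f t (v t) - f t (w t)) (Icc t₀ (t₀ + T)) s‖
        ≤ C₂ * ∑ l ∈ Finset.range (i + 1),
          ‖iteratedDerivWithin l (fun t => v t - w t) (Icc t₀ (t₀ + T)) s‖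

/-! ### The initial value problem and the method -/

/-- `u` solves `u' = f(t,u)` on `[t₀, t₀+T]` with `u(t₀) = u₀`. -/
def IsIVPSolution {d : ℕ} (f : ℝ → E d → E d) (t₀ T : ℝ) (u₀ : E d) (u : ℝ → E d) : Prop :=
  u t₀ = u₀ ∧ ∀ t ∈ Icc t₀ (t₀ + T), HasDerivWithinAt u (f t (u t)) (Icc t₀ (t₀ + T)) t

/-- `t 0 < t 1 < ⋯ < t N` is a mesh of `[t₀, t₀+T]`. -/
def IsMesh (t₀ T : ℝ) (N : ℕ) (t : ℕ → ℝ) : Prop :=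
  t 0 = t₀ ∧ t N = t₀ + T ∧ ∀ n ∈ Finset.Icc 1 N, t (n - 1) < t n

/-- `V` (the polynomial, extended to `ℝ`) solves the local problem on `(a,b]` with incoming
value `Uin`. -/
structure IsLocalSolution {d kI kA : ℕ} (r k : ℕ) (Q : RefIntegrator kI) (A : RefApprox kA)
    (f : ℝ → E d → E d) (a b : ℝ) (Uin : E d) (V : ℝ → E d) : Prop where
  poly : IsVecPoly r V
  init : 1 ≤ k → V a = Uin
  deriv_right : ∀ i < k / 2,
    iteratedDeriv (i + 1) V b = iteratedDerivWithin i (fun t => f t (V t)) (Icc a b) b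
  deriv_left : ∀ i < (k - 1) / 2,
    iteratedDeriv (i + 1) V a = iteratedDerivWithin i (fun t => f t (V t)) (Icc a b) a
  variational : ∀ φ : ℝ → E d, IsVecPoly (r - k) φ →
    locInt Q a b (fun t => inner ℝ (deriv V t) (φ t))
        + (if k = 0 then inner ℝ (V a - Uin) (φ a) else 0)
      = locInt Q a b (fun t => inner ℝ (locApprox A a b (fun s => f s (V s)) t) (φ t))

/-- `U n` is, for `1 ≤ n ≤ N`, the polynomial which is the discrete solution on
`I_n = (t (n-1), t n]`; the incoming value on `I_n` is the left-sided limit at `t (n-1)`, which is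
`u₀` for `n = 1`. -/
def IsDiscreteSolution {d kI kA : ℕ} (r k : ℕ) (Q : RefIntegrator kI) (A : RefApprox kA)
    (f : ℝ → E d → E d) (u₀ : E d) (N : ℕ) (t : ℕ → ℝ) (U : ℕ → ℝ → E d) : Prop :=
  ∀ n ∈ Finset.Icc 1 N, IsLocalSolution r k Q A f (t (n - 1)) (t n)
    (if n = 1 then u₀ else U (n - 1) (t (n - 1))) (U n)

/-! ### The approximation operators of the error estimate -/

/-- The conditions defining the approximation operator `𝒥` on `[a,b]`: `w = 𝒥 v`. -/
structure IsJ {d kI kA : ℕ} (r k : ℕ) (Q : RefIntegrator kI) (A : RefApprox kA)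
    (a b : ℝ) (v w : ℝ → E d) : Prop where
  poly : IsVecPoly r w
  left : 1 ≤ k → ∀ i ≤ (k - 1) / 2, iteratedDeriv i w a = iteratedDerivWithin i v (Icc a b) a
  right : ∀ i ∈ Finset.Icc 1 (k / 2), iteratedDeriv i w b = iteratedDerivWithin i v (Icc a b) b
  variational : ∀ φ : ℝ → E d, IsVecPoly (r - k) φ →
    locInt Q a b (fun t => inner ℝ (deriv w t) (φ t))
        + (if k = 0 then inner ℝ (w a) (φ a) else 0)
      = locInt Q a b (fun t => inner ℝ (locApprox A a b (derivWithin v (Icc a b)) t) (φ t))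
        + (if k = 0 then inner ℝ (v a) (φ a) else 0)

/-- The approximation operator `𝒥` on `[a,b]`: the polynomial determined by `IsJ`. -/
def opJ {d kI kA : ℕ} (r k : ℕ) (Q : RefIntegrator kI) (A : RefApprox kA)
    (a b : ℝ) (v : ℝ → E d) : ℝ → E d :=
  Classical.epsilon fun w => IsJ r k Q A a b v w

/-- The pairs `(x, l)` of a reference point and an order of derivative that has to be preserved:
orders `< ⌊k/2⌋` in `1`, orders `< ⌊(k-1)/2⌋` in `-1`, orders `≤ κ_m` in `x_m`. In every point the
orders form an initial segment of `ℕ`, so that the conditions are independent. -/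
def hermiteConds {K : ℕ} (k : ℕ) (x : Fin (K + 1) → ℝ) (κ : Fin (K + 1) → ℕ) : Finset (ℝ × ℕ) :=
  (Finset.range (k / 2)).image (fun l => ((1 : ℝ), l))
    ∪ (Finset.range ((k - 1) / 2)).image (fun l => ((-1 : ℝ), l))
    ∪ Finset.univ.biUnion fun m => (Finset.range (κ m + 1)).image fun l => (x m, l)

/-- The number `r^app` of independent conditions. -/
def rApp {K : ℕ} (k : ℕ) (x : Fin (K + 1) → ℝ) (κ : Fin (K + 1) → ℕ) : ℕ :=
  (hermiteConds k x κ).card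

/-- `X` is an admissible choice of the `max {0, r + 1 - r^app}` further interpolation points. -/
def IsExtra {K : ℕ} (r k : ℕ) (x : Fin (K + 1) → ℝ) (κ : Fin (K + 1) → ℕ) (X : Finset ℝ) : Prop :=
  X.card = r + 1 - rApp k x κ ∧ ∀ z ∈ X, z ∈ Ioo (-1 : ℝ) 1 ∧ ∀ m, z ≠ x m

/-- `w` is the Hermite-type interpolant of `v` on `[a,b]`. -/
def IsApp {d K : ℕ} (r k : ℕ) (x : Fin (K + 1) → ℝ) (κ : Fin (K + 1) → ℕ) (X : Finset ℝ)
    (a b : ℝ) (v w : ℝ → E d) : Prop :=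
  IsVecPoly (max (rApp k x κ - 1) r) w ∧
  (∀ c ∈ hermiteConds k x κ,
    iteratedDeriv c.2 w (aff a b c.1) = iteratedDerivWithin c.2 v (Icc a b) (aff a b c.1)) ∧
  ∀ z ∈ X, w (aff a b z) = v (aff a b z)

/-- The auxiliary Hermite interpolation operator on `[a,b]`. -/
def opApp {d K : ℕ} (r k : ℕ) (x : Fin (K + 1) → ℝ) (κ : Fin (K + 1) → ℕ) (X : Finset ℝ)
    (a b : ℝ) (v : ℝ → E d) : ℝ → E d :=
  Classical.epsilon fun w => IsApp r k x κ X a b v w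

end VTD

end

noncomputable section

namespace VTD

/-! The error is split as `u - U = (u - 𝒥u) - (U - 𝒥u)`. Because `u' = f(·,u)`, the conditions
defining `𝒥u` say that it is one step of the method with the frozen right-hand side `t ↦ f(t, u(t))`
and incoming value `u(t_{n-1})`, while `U` is one step with `t ↦ f(t, U(t))` and its own incoming
value. Both are instances of `IsStep`, which is linear in its data, so `e = U - 𝒥u` is governed by
`g = f(·,U) - f(·,u)` and by the difference `z` of the incoming values.

On the reference interval `e'` solves a square linear problem: Assumption 1 makes `r` functionals
separate the polynomials of degree less than `r` (`refFunctional_separating`). Expanding in a dual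
family, with Assumptions 2 and 3 controlling the moments, bounds `e'` by the supremum of `g` and by
its derivatives at the Hermite points (`exists_refMatch_bound`).

Assumption 4 turns those derivatives into derivatives of `U - u`, which values alone do not control.
At the Hermite points, however, `u` and its interpolant have the same derivatives, so `U - u` may be
replaced by the polynomial `U - 𝓘^app u`; an inverse inequality applies and the powers of the step
length match (`exists_rhs_diff_bound`).

With `S = sup ‖e‖` and `α` the approximation error this gives `‖e'‖ ≤ C C₂ (α + S)`, and the value
of `e` at the left end differs from `z` by at most `C C₂ τ (α + S)` (`exists_local_error_bound`).
For small `C₂ τ` the term `S` is absorbed (`bounds_of_self_bound`), leaving `‖e(t_n)‖ ≤ (1 + cτ) ‖z‖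
+ cτ α`. Writing the nodal value of `u - 𝒥u` as `τ` times its quotient by `τ` yields a recursion for
the nodal errors, closed by `discrete_gronwall`. -/

open Polynomial in
/-- The vector-valued polynomial function with components `p i`. -/
def vecEval {d : ℕ} (p : Fin d → ℝ[X]) (t : ℝ) : E d := WithLp.toLp 2 fun i => (p i).eval t

/-! ### Polynomial functions, dual families, Hermite interpolation and inverse inequalities -/

section PolynomialFunctions

open Polynomial

variable {d : ℕ}

@[simp] theorem vecEval_apply (p : Fin d → ℝ[X]) (t : ℝ) (i : Fin d) :
    vecEval p t i = (p i).eval t := rfl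

theorem isVecPoly_iff {s : ℕ} {v : ℝ → E d} :
    IsVecPoly s v ↔ ∃ p : Fin d → ℝ[X], (∀ i, (p i).natDegree ≤ s) ∧ v = vecEval p := by
  refine exists_congr fun p => and_congr_right fun _ => ⟨fun h => ?_, fun h => by simp [h]⟩
  ext t i
  simp [h]

theorem hasDerivAt_vecEval (p : Fin d → ℝ[X]) (t : ℝ) :
    HasDerivAt (vecEval p) (vecEval (fun i => derivative (p i)) t) t := by
  rw [hasDerivAt_iff_hasFDerivAt, ← hasFDerivWithinAt_univ, hasFDerivWithinAt_euclidean]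
  intro i
  exact ((p i).hasDerivAt t).hasFDerivAt.hasFDerivWithinAt.congr_fderiv (by ext; simp)

theorem deriv_vecEval (p : Fin d → ℝ[X]) :
    deriv (vecEval p) = vecEval fun i => derivative (p i) :=
  funext fun t => (hasDerivAt_vecEval p t).deriv

theorem iteratedDeriv_vecEval (j : ℕ) (p : Fin d → ℝ[X]) :
    iteratedDeriv j (vecEval p) = vecEval fun i => derivative^[j] (p i) := by
  induction j generalizing p with
  | zero => simp
  | succ j ih => rw [iteratedDeriv_succ', deriv_vecEval, ih]; rfl

theorem contDiff_vecEval (p : Fin d → ℝ[X]) {n : WithTop ℕ∞} : ContDiff ℝ n (vecEval p) := by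
  rw [contDiff_euclidean]
  intro i
  simpa using (p i).contDiff_aeval (𝕜 := ℝ) n

theorem vecEval_comp_affine (p : Fin d → ℝ[X]) (α β x : ℝ) :
    vecEval p (α + β * x) = vecEval (fun i => (p i).comp (C α + C β * X)) x := by
  ext i
  simp

theorem natDegree_comp_affine_le (p : ℝ[X]) (α β : ℝ) :
    (p.comp (C α + C β * X)).natDegree ≤ p.natDegree := by
  refine natDegree_comp_le.trans ?_
  have : (C α + C β * X : ℝ[X]).natDegree ≤ 1 := by
    rw [add_comm]; exact natDegree_linear_le
  nlinarith

theorem IsVecPoly.comp_affine {s : ℕ} {v : ℝ → E d} (hv : IsVecPoly s v) (α β : ℝ) :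
    IsVecPoly s fun x => v (α + β * x) := by
  obtain ⟨p, hp, rfl⟩ := isVecPoly_iff.1 hv
  exact isVecPoly_iff.2 ⟨_, fun i => (natDegree_comp_affine_le _ α β).trans (hp i),
    funext fun x => vecEval_comp_affine p α β x⟩

theorem mem_degreeLT_succ_iff {n : ℕ} {p : ℝ[X]} :
    p ∈ degreeLT ℝ (n + 1) ↔ p.natDegree ≤ n := by
  rw [mem_degreeLT, natDegree_le_iff_degree_le]
  exact degree_lt_iff_coeff_zero _ _ |>.trans (by
    rw [degree_le_iff_coeff_zero]
    exact forall_congr' fun m => by rw [Nat.cast_lt, Nat.succ_le_iff])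

theorem derivative_mem_degreeLT {n : ℕ} {p : ℝ[X]} (hp : p.natDegree ≤ n) :
    derivative p ∈ degreeLT ℝ n := by
  rcases n with _ | n
  · rw [eq_C_of_natDegree_le_zero hp]
    simp
  · rw [mem_degreeLT_succ_iff]
    exact (natDegree_derivative_le p).trans (by lia)

theorem exists_derivative_eq {n : ℕ} {q : ℝ[X]} (hq : q ∈ degreeLT ℝ n) (x c : ℝ) :
    ∃ p : ℝ[X], p.natDegree ≤ n ∧ derivative p = q ∧ p.eval x = c := by
  obtain ⟨p, hp, hpq⟩ : ∃ p : ℝ[X], p.natDegree ≤ n ∧ derivative p = q := by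
    refine ⟨∑ i ∈ Finset.range n, C (q.coeff i / (i + 1)) * X ^ (i + 1), ?_, ?_⟩
    · refine natDegree_sum_le_of_forall_le _ _ fun i hi => ?_
      exact (natDegree_C_mul_X_pow_le _ _).trans (by simpa using hi)
    · rcases n with _ | n
      · have : ∀ m, q.coeff m = 0 := by
          simpa using (degree_lt_iff_coeff_zero _ _).1 (mem_degreeLT.1 hq)
        ext m; simp [this m]
      · conv_rhs =>
          rw [q.as_sum_range_C_mul_X_pow' (Nat.lt_succ_of_le (mem_degreeLT_succ_iff.1 hq))]
        rw [derivative_sum]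
        refine Finset.sum_congr rfl fun i _ => ?_
        have : (i : ℝ) + 1 ≠ 0 := by positivity
        rw [derivative_C_mul_X_pow]
        congr 2
        push_cast
        field_simp
  refine ⟨p + C (c - p.eval x), ?_, by simp [hpq], by simp⟩
  rw [natDegree_add_C]; exact hp

theorem X_sub_C_pow_dvd_of_eval_iterate_derivative {p : ℝ[X]} {a : ℝ} {m : ℕ}
    (h : ∀ i < m, (derivative^[i] p).eval a = 0) : (X - C a) ^ m ∣ p := by
  rcases eq_or_ne p 0 with rfl | hp
  · exact dvd_zero _
  rcases m with _ | m
  · simp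
  rw [← le_rootMultiplicity_iff hp]
  exact lt_rootMultiplicity_of_isRoot_iterate_derivative hp fun i hi => h i (by lia)

/-- A finite family of functionals that separates the polynomials of degree less than `n` admits
a dual family. -/
theorem exists_dual_family {n : ℕ} {ι : Type*} [Fintype ι] (L : ι → ℝ[X] →ₗ[ℝ] ℝ)
    (h : ∀ p ∈ degreeLT ℝ n, (∀ i, L i p = 0) → p = 0) :
    ∃ b : ι → ℝ[X], ∀ p ∈ degreeLT ℝ n, p = ∑ i, L i p • b i := by
  classical
  -- Separation makes `Φ` injective; the dual family consists of the images of the unit vectors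
  -- under a left inverse. Having more functionals than dimensions does no harm.
  let Φ : degreeLT ℝ n →ₗ[ℝ] ι → ℝ := LinearMap.pi fun i => L i ∘ₗ (degreeLT ℝ n).subtype
  have hΦ : LinearMap.ker Φ = ⊥ := by
    rw [LinearMap.ker_eq_bot']
    rintro ⟨p, hp⟩ hz
    exact Subtype.ext (h p hp fun i => congrFun hz i)
  obtain ⟨Ψ, hΨ⟩ := Φ.exists_leftInverse_of_injective hΦ
  refine ⟨fun i => (Ψ (Pi.single i 1) : degreeLT ℝ n), fun p hp => ?_⟩
  have h1 : Ψ (Φ ⟨p, hp⟩) = ⟨p, hp⟩ := LinearMap.congr_fun hΨ _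
  have h2 : Φ ⟨p, hp⟩ = ∑ i, L i p • (Pi.single i 1 : ι → ℝ) := by
    rw [pi_eq_sum_univ' (Φ ⟨p, hp⟩)]
    rfl
  rw [h2, map_sum] at h1
  simpa using (congrArg Subtype.val h1).symm

/-- As many functionals as dimensions: injectivity of the joint evaluation map forces surjectivity.
-/
theorem exists_forall_eq_of_separating {n : ℕ} {ι : Type*} [Fintype ι] (L : ι → ℝ[X] →ₗ[ℝ] ℝ)
    (h : ∀ p ∈ degreeLT ℝ n, (∀ i, L i p = 0) → p = 0) (hn : Fintype.card ι = n) (c : ι → ℝ) :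
    ∃ p ∈ degreeLT ℝ n, ∀ i, L i p = c i := by
  let Φ : degreeLT ℝ n →ₗ[ℝ] ι → ℝ := LinearMap.pi fun i => L i ∘ₗ (degreeLT ℝ n).subtype
  have hΦ : Function.Injective Φ := by
    rw [← LinearMap.ker_eq_bot, LinearMap.ker_eq_bot']
    rintro ⟨p, hp⟩ hz
    exact Subtype.ext (h p hp fun i => congrFun hz i)
  have : FiniteDimensional ℝ (degreeLT ℝ n) := (degreeLTEquiv ℝ n).symm.finiteDimensional
  have hfr : Module.finrank ℝ (degreeLT ℝ n) = Module.finrank ℝ (ι → ℝ) := by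
    rw [(degreeLTEquiv ℝ n).finrank_eq]; simp [hn]
  obtain ⟨⟨p, hp⟩, hpc⟩ := (LinearMap.injective_iff_surjective_of_finrank_eq_finrank hfr).1 hΦ c
  exact ⟨p, hp, fun i => congrFun hpc i⟩

/-- The functional `p ↦ p⁽ʲ⁾(x)`. -/
def evalDeriv (j : ℕ) (x : ℝ) : ℝ[X] →ₗ[ℝ] ℝ := leval x ∘ₗ (derivative ^ j)

@[simp] theorem evalDeriv_apply (j : ℕ) (x : ℝ) (p : ℝ[X]) :
    evalDeriv j x p = (derivative^[j] p).eval x := by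
  simp [evalDeriv, Module.End.pow_apply, leval_apply]

/-- By downward closure, the orders prescribed at a point `c` include all those below their number
`m c`. Hence the pairwise coprime powers `(X - C c) ^ m c` divide `p`, and their product has degree
`S.card`, which is too large for `p ≠ 0`. -/
theorem eq_zero_of_hermite {S : Finset (ℝ × ℕ)} (hS : ∀ c ∈ S, ∀ l ≤ c.2, (c.1, l) ∈ S)
    {p : ℝ[X]} (hp : p ∈ degreeLT ℝ S.card)
    (h : ∀ c ∈ S, (derivative^[c.2] p).eval c.1 = 0) : p = 0 := by
  classical
  let m : ℝ → ℕ := fun c => (S.filter fun q => q.1 = c).card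
  have hm : ∀ c, ∀ i < m c, (c, i) ∈ S := by
    intro c i hi
    by_contra hc
    have hsub : (S.filter fun q => q.1 = c) ⊆ (Finset.range i).image fun l => (c, l) := by
      rintro ⟨q, l⟩ hq
      obtain ⟨hq1, rfl⟩ := Finset.mem_filter.1 hq
      refine Finset.mem_image.2 ⟨l, Finset.mem_range.2 ?_, rfl⟩
      by_contra hl
      exact hc (hS _ hq1 i (not_lt.1 hl))
    have := (Finset.card_le_card hsub).trans Finset.card_image_le
    rw [Finset.card_range] at this
    exact absurd hi (not_lt.2 this)
  have hdvd : ∏ c ∈ S.image Prod.fst, (X - C c) ^ m c ∣ p := by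
    refine Finset.prod_dvd_of_coprime ?_ fun c _ =>
      X_sub_C_pow_dvd_of_eval_iterate_derivative fun i hi => h _ (hm c i hi)
    intro c _ c' _ hcc
    exact (isCoprime_X_sub_C_of_isUnit_sub (sub_ne_zero.2 hcc).isUnit).pow
  refine eq_zero_of_dvd_of_degree_lt hdvd ?_
  have hdeg : (∏ c ∈ S.image Prod.fst, (X - C c) ^ m c).degree = ((S.card : ℕ) : WithBot ℕ) := by
    rw [degree_prod]
    simp only [degree_pow, degree_X_sub_C, nsmul_eq_mul, mul_one]
    rw [Finset.card_eq_sum_card_image Prod.fst S]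
    push_cast
    rfl
  rw [hdeg]
  exact mem_degreeLT.1 hp

/-- Solvability of the Hermite interpolation problem. -/
theorem exists_hermite {S : Finset (ℝ × ℕ)} (hS : ∀ c ∈ S, ∀ l ≤ c.2, (c.1, l) ∈ S)
    (y : ℝ × ℕ → ℝ) :
    ∃ p ∈ degreeLT ℝ S.card, ∀ c ∈ S, (derivative^[c.2] p).eval c.1 = y c := by
  obtain ⟨p, hp, h⟩ := exists_forall_eq_of_separating (n := S.card)
    (fun c : S => evalDeriv c.1.2 c.1.1)
    (fun p hp h => eq_zero_of_hermite hS hp fun c hc => by simpa using h ⟨c, hc⟩)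
    (by simp) (fun c => y c)
  exact ⟨p, hp, fun c hc => by simpa using h ⟨c, hc⟩⟩

/-- The scalar expansion in the dual family is the same in every component, so it is an identity
between vectors with scalar coefficients `F (b j)`. The constants are therefore independent of `d`.
-/
theorem norm_vecEval_le_of_dual {n : ℕ} {ι : Type*} [Fintype ι] {L : ι → ℝ[X] →ₗ[ℝ] ℝ}
    {b : ι → ℝ[X]} (hb : ∀ p ∈ degreeLT ℝ n, p = ∑ i, L i p • b i) (F : ℝ[X] →ₗ[ℝ] ℝ)
    {p : Fin d → ℝ[X]} (hp : ∀ i, p i ∈ degreeLT ℝ n) :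
    ‖(WithLp.toLp 2 fun i => F (p i) : E d)‖
      ≤ ∑ j, |F (b j)| * ‖(WithLp.toLp 2 fun i => L j (p i) : E d)‖ := by
  have h : (WithLp.toLp 2 fun i => F (p i) : E d)
      = ∑ j, F (b j) • (WithLp.toLp 2 fun i => L j (p i) : E d) := by
    ext i
    have := congrArg F (hb (p i) (hp i))
    simpa [map_sum, mul_comm] using this
  rw [h]
  refine (norm_sum_le _ _).trans (le_of_eq ?_)
  simp [norm_smul]

/-- Inverse inequality: derivatives of polynomials are controlled by the values. -/
theorem exists_inverse_inequality (n : ℕ) (j : ℕ) (x : ℝ) : ∃ B : ℝ, 0 ≤ B ∧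
    ∀ (d : ℕ) (p : Fin d → ℝ[X]) (S : ℝ), (∀ i, p i ∈ degreeLT ℝ n) →
      (∀ s ∈ Ioc (-1 : ℝ) 1, ‖vecEval p s‖ ≤ S) →
      ‖vecEval (fun i => derivative^[j] (p i)) x‖ ≤ B * S := by
  -- Any `n` distinct nodes in the interval serve, since values there separate polynomials of degree
  -- less than `n`.
  obtain ⟨y, hy⟩ := (Ioc_infinite (show (-1 : ℝ) < 1 by norm_num)).exists_subset_card_eq n
  have hsep : ∀ p ∈ degreeLT ℝ n, (∀ z : y, leval (z : ℝ) p = 0) → p = 0 := by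
    intro p hp h
    refine eq_zero_of_degree_lt_of_eval_finset_eq_zero (s := y) ?_ fun z hz => h ⟨z, hz⟩
    rw [hy.2]; exact mem_degreeLT.1 hp
  obtain ⟨b, hb⟩ := exists_dual_family _ hsep
  refine ⟨∑ z : y, |evalDeriv j x (b z)|, by positivity, fun d p S hp hS => ?_⟩
  have h := norm_vecEval_le_of_dual hb (evalDeriv j x) hp
  rw [Finset.sum_mul]
  have e : vecEval (fun i => derivative^[j] (p i)) x
      = (WithLp.toLp 2 fun i => evalDeriv j x (p i) : E d) := by
    ext i; simp
  rw [e]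
  refine h.trans (Finset.sum_le_sum fun z _ => ?_)
  exact mul_le_mul_of_nonneg_left (hS z (hy.1 z.2)) (abs_nonneg _)

end PolynomialFunctions

/-! ### The problem on the reference interval -/

section Reference

open Polynomial

variable {d r k kI kA : ℕ}

/-- The reference approximation operator acting component-wise on vector-valued functions. -/
def vecRefApprox (A : RefApprox kA) (ψ : ℝ → E d) : ℝ → E d :=
  fun t => WithLp.toLp 2 fun i => A.toFun (fun x => ψ x i) t

/-- The functional given by the integrator on polynomials. -/
def RefIntegrator.polyFun (Q : RefIntegrator kI) : ℝ[X] →ₗ[ℝ] ℝ where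
  toFun p := Q.toFun fun x => p.eval x
  map_add' p q := by
    simpa using Q.map_add (fun x => p.eval x) (fun x => q.eval x)
      (by simpa using (p.contDiff_aeval (𝕜 := ℝ) kI).contDiffOn)
      (by simpa using (q.contDiff_aeval (𝕜 := ℝ) kI).contDiffOn)
  map_smul' c p := by
    simpa using Q.map_smul c (fun x => p.eval x)
      (by simpa using (p.contDiff_aeval (𝕜 := ℝ) kI).contDiffOn)

theorem RefIntegrator.polyFun_apply (Q : RefIntegrator kI) (p : ℝ[X]) :
    Q.polyFun p = Q.toFun fun x => p.eval x := rfl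

theorem contDiff_polynomial_eval (p : ℝ[X]) {n : WithTop ℕ∞} : ContDiff ℝ n fun x => p.eval x := by
  simpa using p.contDiff_aeval (𝕜 := ℝ) n

/-- The test functions: monomials, multiplied by `1 + t` in the discontinuous case. -/
def testPoly (k j : ℕ) : ℝ[X] := (if k = 0 then X + C 1 else 1) * X ^ j

theorem natDegree_testPoly_le (hkr : k ≤ r) {j : ℕ} (hj : j < r + 1 - max 1 k) :
    (testPoly k j).natDegree ≤ r - k := by
  refine natDegree_mul_le.trans ?_
  rw [natDegree_X_pow]
  split_ifs with h
  · rw [natDegree_X_add_C]; lia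
  · rw [natDegree_one]; lia

/-- The functionals that determine the derivative of a discrete solution. -/
def refFunctional (r k : ℕ) (Q : RefIntegrator kI) :
    Fin (k / 2) ⊕ Fin ((k - 1) / 2) ⊕ Fin (r + 1 - max 1 k) → ℝ[X] →ₗ[ℝ] ℝ :=
  Sum.elim (fun i => evalDeriv i 1) <| Sum.elim (fun i => evalDeriv i (-1)) fun j =>
    Q.polyFun ∘ₗ LinearMap.mulLeft ℝ (testPoly k j)

/-- The truncated `(k - 1) / 2` is `0` at `k = 0`, so the count is `r` in the discontinuous case as
well. -/
theorem card_refFunctional (hkr : k ≤ r) :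
    Fintype.card (Fin (k / 2) ⊕ Fin ((k - 1) / 2) ⊕ Fin (r + 1 - max 1 k)) = r := by
  simp only [Fintype.card_sum, Fintype.card_fin]
  lia

/-- The vanishing derivatives at `±1` split off the factors `(X - 1) ^ (k / 2)` and `(X + 1) ^ ((k -
1) / 2)`. The vanishing moments of the cofactor `ψ` are, up to a sign, the orthogonality relations
of Assumption 1. For `k = 0` the exponent `|⌊-1/2⌋| = 1` there corresponds to the factor `1 + t` of
the test polynomials. -/
theorem refFunctional_separating (hkr : k ≤ r) {Q : RefIntegrator kI} (hQ : AssUnisolvent r k Q)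
    (p : ℝ[X]) (hp : p ∈ degreeLT ℝ r) (h : ∀ i, refFunctional r k Q i p = 0) : p = 0 := by
  have h1 : (X - C 1) ^ (k / 2) ∣ p := X_sub_C_pow_dvd_of_eval_iterate_derivative fun i hi => by
    simpa [refFunctional] using h (Sum.inl ⟨i, hi⟩)
  have h2 : (X - C (-1)) ^ ((k - 1) / 2) ∣ p :=
    X_sub_C_pow_dvd_of_eval_iterate_derivative fun i hi => by
      simpa [refFunctional] using h (Sum.inr (Sum.inl ⟨i, hi⟩))
  obtain ⟨ψ, rfl⟩ : (X - C 1) ^ (k / 2) * (X - C (-1)) ^ ((k - 1) / 2) ∣ p :=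
    IsCoprime.mul_dvd (isCoprime_X_sub_C_of_isUnit_sub (by norm_num)).pow h1 h2
  suffices hψ : ψ = 0 by simp [hψ]
  by_contra hψ0
  have hdeg : ψ ∈ degreeLT ℝ (r + 1 - max 1 k) := by
    have hm : ((X - C (1 : ℝ)) ^ (k / 2) * (X - C (-1)) ^ ((k - 1) / 2)).Monic :=
      ((monic_X_sub_C _).pow _).mul ((monic_X_sub_C _).pow _)
    rw [mem_degreeLT, ← natDegree_lt_iff_degree_lt hψ0]
    rw [mem_degreeLT, ← natDegree_lt_iff_degree_lt (by
      rw [mul_ne_zero_iff]; exact ⟨hm.ne_zero, hψ0⟩), hm.natDegree_mul' hψ0,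
      ((monic_X_sub_C _).pow _).natDegree_mul ((monic_X_sub_C _).pow _)] at hp
    simp only [natDegree_pow, natDegree_X_sub_C, mul_one] at hp
    lia
  refine hψ0 (hQ ψ hdeg fun φ hφ => ?_)
  let W : ℝ[X] := (C 1 - X) ^ (k / 2) * (C 1 + X) ^ (((k : ℤ) - 1) / 2).natAbs * ψ
  have hW : ∀ φ : ℝ[X], Q.toFun (fun x => (1 - x) ^ (k / 2) *
      (1 + x) ^ (((k : ℤ) - 1) / 2).natAbs * ψ.eval x * φ.eval x)
      = (Q.polyFun ∘ₗ LinearMap.mulLeft ℝ W) φ := by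
    intro φ
    simp [RefIntegrator.polyFun_apply, W, mul_assoc]
  have hmono : ∀ j < r + 1 - max 1 k, (Q.polyFun ∘ₗ LinearMap.mulLeft ℝ W) (X ^ j) = 0 := by
    intro j hj
    have := h (Sum.inr (Sum.inr ⟨j, hj⟩))
    simp only [refFunctional, Sum.elim_inr, LinearMap.comp_apply, LinearMap.mulLeft_apply] at this
    have e : W * X ^ j = (-1 : ℝ) ^ (k / 2) • (testPoly k j *
        ((X - C 1) ^ (k / 2) * (X - C (-1)) ^ ((k - 1) / 2) * ψ)) := by
      have e1 : (C 1 - X : ℝ[X]) ^ (k / 2) = (-1 : ℝ) ^ (k / 2) • (X - C 1) ^ (k / 2) := by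
        rw [← neg_sub, neg_pow, smul_eq_C_mul]; simp
      have e2 : (C 1 + X : ℝ[X]) ^ (((k : ℤ) - 1) / 2).natAbs
          = (if k = 0 then X + C 1 else 1) * (X - C (-1)) ^ ((k - 1) / 2) := by
        rcases Nat.eq_zero_or_pos k with rfl | hk
        · simp [add_comm]
        · have : (((k : ℤ) - 1) / 2).natAbs = (k - 1) / 2 := by lia
          rw [this, if_neg hk.ne']
          simp [add_comm]
      simp only [W, testPoly, e1, e2, smul_eq_C_mul]
      ring
    rw [LinearMap.comp_apply, LinearMap.mulLeft_apply, e, map_smul, this, smul_zero]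
  rw [hW]
  rw [degreeLT_eq_span_X_pow] at hφ
  refine Submodule.span_induction ?_ (map_zero _) (fun a b _ _ ha hb => by rw [map_add, ha, hb,
    add_zero]) (fun c a _ ha => by rw [map_smul, ha, smul_zero]) hφ
  intro a ha
  obtain ⟨j, hj, rfl⟩ : ∃ j, j < r + 1 - max 1 k ∧ X ^ j = a := by simpa using ha
  exact hmono j hj

/-- The polynomial `p` satisfies the defining conditions of the derivative of a discrete solution
with right-hand side `ψ` on the reference interval. -/
structure IsRefMatch (r k : ℕ) (Q : RefIntegrator kI) (A : RefApprox kA) (ψ : ℝ → E d)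
    (p : Fin d → ℝ[X]) : Prop where
  mem : ∀ i, p i ∈ degreeLT ℝ r
  right : ∀ i < k / 2,
    vecEval (fun n => derivative^[i] (p n)) 1 = iteratedDerivWithin i ψ (Icc (-1) 1) 1
  left : ∀ i < (k - 1) / 2,
    vecEval (fun n => derivative^[i] (p n)) (-1) = iteratedDerivWithin i ψ (Icc (-1) 1) (-1)
  moment : ∀ j < r + 1 - max 1 k,
    vecRefInt Q (fun s => (testPoly k j).eval s • vecEval p s)
      = vecRefInt Q fun s => (testPoly k j).eval s • vecRefApprox A ψ s

theorem exists_isRefMatch (hkr : k ≤ r) {Q : RefIntegrator kI} (hQ : AssUnisolvent r k Q)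
    (A : RefApprox kA) (ψ : ℝ → E d) : ∃ p, IsRefMatch r k Q A ψ p := by
  choose p hp hpc using fun n : Fin d => exists_forall_eq_of_separating (refFunctional r k Q)
    (refFunctional_separating hkr hQ) (card_refFunctional hkr)
    (Sum.elim (fun i => iteratedDerivWithin i ψ (Icc (-1) 1) 1 n) <|
      Sum.elim (fun i => iteratedDerivWithin i ψ (Icc (-1) 1) (-1) n) fun j =>
        (vecRefInt Q fun s => (testPoly k j).eval s • vecRefApprox A ψ s) n)
  refine ⟨p, hp, fun i hi => ?_, fun i hi => ?_, fun j hj => ?_⟩ <;> ext n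
  · simpa [refFunctional] using hpc n (Sum.inl ⟨i, hi⟩)
  · simpa [refFunctional] using hpc n (Sum.inr (Sum.inl ⟨i, hi⟩))
  · have := hpc n (Sum.inr (Sum.inr ⟨j, hj⟩))
    simp only [refFunctional, Sum.elim_inr, LinearMap.comp_apply, LinearMap.mulLeft_apply] at this
    rw [← this]
    simp [vecRefInt, RefIntegrator.polyFun_apply]

theorem contDiffOn_apply {n : WithTop ℕ∞} {s : Set ℝ} {ψ : ℝ → E d} (hψ : ContDiffOn ℝ n ψ s)
    (i : Fin d) : ContDiffOn ℝ n (fun x => ψ x i) s :=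
  contDiffOn_euclidean.1 hψ i

theorem contDiffOn_vecRefApprox (A : RefApprox kA) {l : ℕ} {ψ : ℝ → E d}
    (hψ : ContDiffOn ℝ (max kA l : ℕ) ψ (Icc (-1) 1)) :
    ContDiffOn ℝ l (vecRefApprox A ψ) (Icc (-1) 1) :=
  contDiffOn_euclidean.2 fun i => A.smooth l _ (contDiffOn_apply hψ i)

theorem vecRefInt_congr (Q : RefIntegrator kI) {φ ψ : ℝ → E d} (h : EqOn φ ψ (Icc (-1) 1)) :
    vecRefInt Q φ = vecRefInt Q ψ := by
  ext i
  exact Q.congr_on _ _ fun x hx => by simp only [h hx]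

theorem vecRefInt_sub (Q : RefIntegrator kI) {φ ψ : ℝ → E d}
    (hφ : ContDiffOn ℝ kI φ (Icc (-1) 1)) (hψ : ContDiffOn ℝ kI ψ (Icc (-1) 1)) :
    vecRefInt Q (fun s => φ s - ψ s) = vecRefInt Q φ - vecRefInt Q ψ := by
  ext i
  have h1 := Q.map_smul (-1) _ (contDiffOn_apply hψ i)
  have h2 := Q.map_add (fun s => φ s i) (fun s => (-1) * ψ s i) (contDiffOn_apply hφ i)
    (contDiffOn_const.mul (contDiffOn_apply hψ i))
  rw [h1] at h2
  simp only [vecRefInt, PiLp.sub_apply]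
  rw [neg_one_mul, ← sub_eq_add_neg] at h2
  rw [← h2]
  congr 1
  ext s
  ring

theorem vecRefApprox_congr (A : RefApprox kA) {φ ψ : ℝ → E d} (h : EqOn φ ψ (Icc (-1) 1)) :
    EqOn (vecRefApprox A φ) (vecRefApprox A ψ) (Icc (-1) 1) := by
  intro s hs
  ext i
  exact A.congr_on _ _ (fun x hx => by simp only [h hx]) hs

theorem vecRefApprox_sub (A : RefApprox kA) {φ ψ : ℝ → E d}
    (hφ : ContDiffOn ℝ kA φ (Icc (-1) 1)) (hψ : ContDiffOn ℝ kA ψ (Icc (-1) 1)) :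
    EqOn (vecRefApprox A fun s => φ s - ψ s) (fun s => vecRefApprox A φ s - vecRefApprox A ψ s)
      (Icc (-1) 1) := by
  intro t ht
  ext i
  have h1 := A.map_smul (-1) _ (contDiffOn_apply hψ i) ht
  have h2 := A.map_add (fun s => φ s i) (fun s => (-1) * ψ s i) (contDiffOn_apply hφ i)
    (contDiffOn_const.mul (contDiffOn_apply hψ i)) ht
  have h3 : A.toFun (fun s => (φ s - ψ s) i) t = A.toFun (fun s => φ s i + (-1) * ψ s i) t := by
    congr 1
    ext s
    simp only [PiLp.sub_apply]
    ring
  simp only [vecRefApprox, PiLp.sub_apply] at h1 h2 h3 ⊢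
  rw [h3, h2, h1]
  ring

theorem contDiffOn_eval_smul (θ : ℝ[X]) {n : WithTop ℕ∞} {s : Set ℝ} {ψ : ℝ → E d}
    (hψ : ContDiffOn ℝ n ψ s) : ContDiffOn ℝ n (fun x => θ.eval x • ψ x) s :=
  (contDiff_polynomial_eval θ).contDiffOn.smul hψ

theorem uniqueDiffOn_ref : UniqueDiffOn ℝ (Icc (-1 : ℝ) 1) := uniqueDiffOn_Icc (by norm_num)

/-- Linearity of `Q` and `A` and additivity of derivatives are available for sufficiently smooth
functions only; this is the role of the lower bound on `n`. -/
theorem IsRefMatch.sub {Q : RefIntegrator kI} {A : RefApprox kA} {φ ψ : ℝ → E d}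
    {p q : Fin d → ℝ[X]} (hp : IsRefMatch r k Q A φ p) (hq : IsRefMatch r k Q A ψ q)
    {n : ℕ} (hn : max (k / 2 - 1) (max kI kA) ≤ n)
    (hφ : ContDiffOn ℝ n φ (Icc (-1) 1)) (hψ : ContDiffOn ℝ n ψ (Icc (-1) 1)) :
    IsRefMatch r k Q A (fun s => φ s - ψ s) fun i => p i - q i := by
  have hle : ∀ {m : ℕ}, m ≤ n → (m : WithTop ℕ∞) ≤ n := fun h => by exact_mod_cast h
  have key : ∀ i : ℕ, i ≤ n → ∀ s ∈ Icc (-1 : ℝ) 1,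
      iteratedDerivWithin i (fun s => φ s - ψ s) (Icc (-1) 1) s
        = iteratedDerivWithin i φ (Icc (-1) 1) s - iteratedDerivWithin i ψ (Icc (-1) 1) s :=
    fun i hi s hs => iteratedDerivWithin_sub hs uniqueDiffOn_ref ((hφ s hs).of_le (hle hi))
      ((hψ s hs).of_le (hle hi))
  have hev : ∀ (a b : Fin d → ℝ[X]) s,
      vecEval (fun i => a i - b i) s = vecEval a s - vecEval b s := by
    intro a b s; ext i; simp
  refine ⟨fun i => Submodule.sub_mem _ (hp.mem i) (hq.mem i), fun i hi => ?_, fun i hi => ?_,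
    fun j hj => ?_⟩
  · rw [key i (by lia) 1 (by simp), ← hp.right i hi, ← hq.right i hi, ← hev]
    simp
  · rw [key i (by lia) (-1) (by simp), ← hp.left i hi, ← hq.left i hi, ← hev]
    simp
  · have hm : max kA kI ≤ n := by lia
    have h1 : vecRefInt Q (fun s => (testPoly k j).eval s • vecRefApprox A (fun s => φ s - ψ s) s)
        = vecRefInt Q fun s => (testPoly k j).eval s • vecRefApprox A φ s
          - (testPoly k j).eval s • vecRefApprox A ψ s :=
      vecRefInt_congr Q fun s hs => by
        simp only [vecRefApprox_sub A (hφ.of_le (hle (by lia))) (hψ.of_le (hle (by lia))) hs,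
          smul_sub]
    rw [h1, vecRefInt_sub Q (contDiffOn_eval_smul _ (contDiffOn_vecRefApprox A (hφ.of_le (hle hm))))
        (contDiffOn_eval_smul _ (contDiffOn_vecRefApprox A (hψ.of_le (hle hm)))),
      ← hp.moment j hj, ← hq.moment j hj, ← vecRefInt_sub Q
        (contDiffOn_eval_smul _ (contDiff_vecEval p).contDiffOn)
        (contDiffOn_eval_smul _ (contDiff_vecEval q).contDiffOn)]
    simp only [hev, smul_sub]

end Reference

/-! ### Supremum norms on half-open intervals -/

section SupNorm

variable {d : ℕ}

theorem supNorm_le {s : Set ℝ} (hs : s.Nonempty) {g : ℝ → E d} {B : ℝ}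
    (h : ∀ t ∈ s, ‖g t‖ ≤ B) : supNorm s g ≤ B := by
  have := hs.to_subtype
  exact ciSup_le fun t => h t t.2

theorem supNorm_nonneg (s : Set ℝ) (g : ℝ → E d) : 0 ≤ supNorm s g :=
  Real.iSup_nonneg fun _ => norm_nonneg _

theorem norm_le_supNorm_Ioc {a b : ℝ} {g : ℝ → E d} (hg : ContinuousOn g (Icc a b)) {t : ℝ}
    (ht : t ∈ Ioc a b) : ‖g t‖ ≤ supNorm (Ioc a b) g := by
  obtain ⟨B, hB⟩ := isCompact_Icc.exists_bound_of_continuousOn hg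
  exact le_ciSup (f := fun t : Ioc a b => ‖g t‖)
    ⟨B, by rintro _ ⟨t, rfl⟩; exact hB t (Ioc_subset_Icc_self t.2)⟩ ⟨t, ht⟩

/-- The suprema in the error estimate omit the left endpoint, but the jump and the mean value
argument need it; continuity supplies the missing point. -/
theorem norm_le_of_forall_Ioc {a b B : ℝ} (hab : a < b) {g : ℝ → E d}
    (hg : ContinuousOn g (Icc a b)) (h : ∀ t ∈ Ioc a b, ‖g t‖ ≤ B) : ∀ t ∈ Icc a b, ‖g t‖ ≤ B := by
  intro t ht
  rw [← closure_Ioc hab.ne] at ht hg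
  exact isClosed_Iic.closure_subset
    ((hg.norm.image_closure) (mem_image_of_mem _ ht) |> closure_mono
      (by rintro _ ⟨s, hs, rfl⟩; exact h s hs))

theorem norm_le_supNorm_Icc {a b : ℝ} (hab : a < b) {g : ℝ → E d}
    (hg : ContinuousOn g (Icc a b)) {t : ℝ} (ht : t ∈ Icc a b) :
    ‖g t‖ ≤ supNorm (Ioc a b) g :=
  norm_le_of_forall_Ioc hab hg (fun _ hs => norm_le_supNorm_Ioc hg hs) t ht

end SupNorm

/-! ### Stability of the reference problem -/

section ReferenceBounds

open Polynomial

variable {d r k kI kA K : ℕ}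

/-- Leibniz rule. The derivatives of `G` are assumed bounded only at the single point `s`, which is
all that the point sums of alternative (B) provide. -/
theorem exists_bound_eval_smul (θ : ℝ[X]) (n : ℕ) : ∃ B : ℝ, 0 ≤ B ∧
    ∀ (d : ℕ) (G : ℝ → E d) (D : ℝ), ContDiffOn ℝ n G (Icc (-1) 1) → ∀ s ∈ Icc (-1 : ℝ) 1,
      ∀ j ≤ n, (∀ l ≤ j, ‖iteratedDerivWithin l G (Icc (-1) 1) s‖ ≤ D) →
      ‖iteratedDerivWithin j (fun x => θ.eval x • G x) (Icc (-1) 1) s‖ ≤ B * D := by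
  have hb : ∀ i : ℕ, ∃ c : ℝ, ∀ s ∈ Icc (-1 : ℝ) 1,
      ‖iteratedDerivWithin i (fun x => θ.eval x) (Icc (-1) 1) s‖ ≤ c := fun i =>
    isCompact_Icc.exists_bound_of_continuousOn
      ((contDiff_polynomial_eval (n := i) θ).contDiffOn.continuousOn_iteratedDerivWithin le_rfl
        uniqueDiffOn_ref)
  choose c hc using hb
  refine ⟨∑ j ∈ Finset.range (n + 1), ∑ i ∈ Finset.range (j + 1), (j.choose i : ℝ) * |c i|,
    by positivity, fun d G D hG s hs j hj hD => ?_⟩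
  have hD0 : 0 ≤ D := (norm_nonneg _).trans (hD 0 (by simp))
  have h := norm_iteratedFDerivWithin_smul_le (contDiff_polynomial_eval (n := n) θ).contDiffOn hG
    uniqueDiffOn_ref hs (n := j) (by exact_mod_cast hj)
  simp only [norm_iteratedFDerivWithin_eq_norm_iteratedDerivWithin] at h
  refine h.trans ?_
  refine le_trans (b := (∑ i ∈ Finset.range (j + 1), (j.choose i : ℝ) * |c i|) * D) ?_ ?_
  · rw [Finset.sum_mul]
    refine Finset.sum_le_sum fun i _ => ?_
    gcongr
    · exact (hc i s hs).trans (le_abs_self _)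
    · exact hD _ (by lia)
  · gcongr
    exact Finset.single_le_sum
      (f := fun j => ∑ i ∈ Finset.range (j + 1), (j.choose i : ℝ) * |c i|)
      (fun _ _ => by positivity) (Finset.mem_range.2 (by lia))

theorem aff_ref (x : ℝ) : aff (-1) 1 x = x := by simp [aff]

theorem affInv_aff {a b : ℝ} (hab : a < b) (x : ℝ) : affInv a b (aff a b x) = x := by
  have : b - a ≠ 0 := (sub_pos.2 hab).ne'
  simp only [aff, affInv]
  field_simp
  ring

theorem locApprox_aff (A : RefApprox kA) {a b : ℝ} (hab : a < b) (ψ : ℝ → E d) (x : ℝ) :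
    locApprox A a b ψ (aff a b x) = vecRefApprox A (fun s => ψ (aff a b s)) x := by
  simp [locApprox, vecRefApprox, affInv_aff hab]

theorem locApprox_ref (A : RefApprox kA) (ψ : ℝ → E d) :
    locApprox A (-1) 1 ψ = vecRefApprox A ψ := by
  ext1 x
  have := locApprox_aff A (show (-1 : ℝ) < 1 by norm_num) ψ x
  simpa [aff_ref] using this

theorem vecLocInt_ref (Q : RefIntegrator kI) (φ : ℝ → E d) :
    vecLocInt Q (-1) 1 φ = vecRefInt Q φ := by
  ext i
  simp only [vecLocInt, locInt, aff_ref, vecRefInt]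
  norm_num

theorem pointSum_ref (x : Fin (K + 1) → ℝ) (κ : Fin (K + 1) → ℕ) (φ : ℝ → E d) :
    pointSum x κ (-1) 1 φ = ∑ m, ∑ j ∈ Finset.range (κ m + 1),
      ‖iteratedDerivWithin j φ (Icc (-1) 1) (x m)‖ := by
  simp only [pointSum, aff_ref]
  norm_num

theorem pointSum_ref_le (x : Fin (K + 1) → ℝ) (κ : Fin (K + 1) → ℕ) (φ : ℝ → E d) {D : ℝ}
    (h : ∀ m, ∀ j ≤ κ m, ‖iteratedDerivWithin j φ (Icc (-1) 1) (x m)‖ ≤ D) :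
    pointSum x κ (-1) 1 φ ≤ (∑ m, ((κ m : ℝ) + 1)) * D := by
  rw [pointSum_ref, Finset.sum_mul]
  refine Finset.sum_le_sum fun m _ => ?_
  refine (Finset.sum_le_card_nsmul _ _ D fun j hj => h m j ?_).trans (by simp)
  simpa [Nat.lt_succ_iff] using hj

theorem pointSum_nonneg (x : Fin (K + 1) → ℝ) (κ : Fin (K + 1) → ℕ) {a b : ℝ} (hab : a < b)
    (φ : ℝ → E d) : 0 ≤ pointSum x κ a b φ := by
  have := (sub_pos.2 hab).le
  unfold pointSum
  positivity

theorem norm_le_pointSum_ref (x : Fin (K + 1) → ℝ) (κ : Fin (K + 1) → ℕ) (φ : ℝ → E d)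
    {m : Fin (K + 1)} {j : ℕ} (hj : j ≤ κ m) :
    ‖iteratedDerivWithin j φ (Icc (-1) 1) (x m)‖ ≤ pointSum x κ (-1) 1 φ := by
  rw [pointSum_ref]
  refine le_trans ?_ (Finset.single_le_sum (f := fun m => ∑ j ∈ Finset.range (κ m + 1),
      ‖iteratedDerivWithin j φ (Icc (-1) 1) (x m)‖) (fun _ _ => by positivity)
      (Finset.mem_univ m))
  exact Finset.single_le_sum (f := fun j => ‖iteratedDerivWithin j φ (Icc (-1) 1) (x m)‖)
    (fun _ _ => norm_nonneg _) (Finset.mem_range.2 (by lia))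

theorem mul_le_abs_mul {c s t : ℝ} (hs : 0 ≤ s) (hst : s ≤ t) : c * s ≤ |c| * t :=
  (mul_le_mul_of_nonneg_right (le_abs_self c) hs).trans
    (mul_le_mul_of_nonneg_left hst (abs_nonneg c))

/-- Under (A), all derivatives of the approximation up to order `kI` are bounded and Assumption 2
applies. Under (B), the integrator sees only point derivatives and the supremum norm of its
argument, and these are bounded directly. Only the instance `a = -1`, `b = 1` of Assumption 3 is
needed, because all problems are transformed to the reference interval. -/
theorem exists_bound_refInt_refApprox {Q : RefIntegrator kI} {A : RefApprox kA}
    (hQb : AssBounded d Q) {x : Fin (K + 1) → ℝ} {κ : Fin (K + 1) → ℕ}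
    (hP : AssPointA d kI A x κ ∨ AssPointB d Q A x κ) (θ : ℝ[X]) : ∃ B : ℝ, 0 ≤ B ∧
    ∀ (ψ : ℝ → E d) (D : ℝ), ContDiffOn ℝ (max kI kA : ℕ) ψ (Icc (-1) 1) →
      (∀ m, ∀ j ≤ κ m, ‖iteratedDerivWithin j ψ (Icc (-1) 1) (x m)‖ ≤ D) →
      (∀ s ∈ Icc (-1 : ℝ) 1, ‖ψ s‖ ≤ D) →
      ‖vecRefInt Q fun s => θ.eval s • vecRefApprox A ψ s‖ ≤ B * D := by
  obtain ⟨Bθ, hBθ, hθ⟩ := exists_bound_eval_smul θ kI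
  have h11 : (-1 : ℝ) < 1 := by norm_num
  have hsup : ∀ (ψ : ℝ → E d) (D : ℝ), (∀ s ∈ Icc (-1 : ℝ) 1, ‖ψ s‖ ≤ D) →
      supNorm (Ioc (-1) 1) ψ ≤ D := fun ψ D h =>
    supNorm_le (nonempty_Ioc.2 h11) fun t ht => h t (Ioc_subset_Icc_self ht)
  have hP0 : 0 ≤ ∑ m, ((κ m : ℝ) + 1) := Finset.sum_nonneg fun m _ => by positivity
  rcases hP with ⟨-, C₁, C₂, hA⟩ | ⟨-, K', y, lam, -, hy, hlam, ⟨C₁, C₂, hI⟩, C₁', C₂', hA⟩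
  · obtain ⟨C₀, hC₀⟩ := hQb
    set B₁ : ℝ := |C₁| * ∑ m, ((κ m : ℝ) + 1) + |C₂|
    have hB₁ : 0 ≤ B₁ := by positivity
    refine ⟨|C₀| * ((kI + 1) * (Bθ * B₁)), by positivity, fun ψ D hψ hpt hs => ?_⟩
    have hG : ContDiffOn ℝ kI (vecRefApprox A ψ) (Icc (-1) 1) :=
      contDiffOn_vecRefApprox A (by rwa [max_comm])
    have hGl : ∀ l ≤ kI, ∀ s ∈ Icc (-1 : ℝ) 1,
        ‖iteratedDerivWithin l (vecRefApprox A ψ) (Icc (-1) 1) s‖ ≤ B₁ * D := by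
      intro l hl s hs'
      refine (norm_le_supNorm_Icc h11 (hG.continuousOn_iteratedDerivWithin
        (by exact_mod_cast hl) uniqueDiffOn_ref) hs').trans ?_
      have h1 := (hA (-1) 1 h11 l hl ψ (hψ.of_le (by exact_mod_cast le_max_right _ _))).2
      rw [locApprox_ref] at h1
      have h2 : ((1 - -1 : ℝ) / 2) ^ l = 1 := by norm_num
      rw [h2, one_mul] at h1
      have h3 := mul_le_abs_mul (c := C₁) (pointSum_nonneg x κ h11 ψ) (pointSum_ref_le x κ ψ hpt)
      have h4 := mul_le_abs_mul (c := C₂) (supNorm_nonneg _ ψ) (hsup ψ D hs)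
      refine h1.trans ((add_le_add h3 h4).trans (le_of_eq ?_))
      simp only [B₁]
      ring
    refine (hC₀ _ (contDiffOn_eval_smul θ hG)).trans ?_
    rw [mul_assoc |C₀|]
    refine mul_le_abs_mul (Finset.sum_nonneg fun _ _ => supNorm_nonneg _ _) ?_
    refine (Finset.sum_le_card_nsmul _ _ (Bθ * B₁ * D) fun j hj => ?_).trans (le_of_eq ?_)
    · have hj' : j ≤ kI := by simpa [Nat.lt_succ_iff] using hj
      refine supNorm_le (nonempty_Icc.2 h11.le) fun t ht => ?_
      rw [mul_assoc]
      exact hθ d _ _ hG t ht j hj' fun l hl => hGl l (hl.trans hj') t ht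
    · simp
      ring
  · set B₁ : ℝ := |C₁'| * ∑ m, ((κ m : ℝ) + 1) + |C₂'|
    have hB₁ : 0 ≤ B₁ := by positivity
    have hL0 : 0 ≤ ∑ m, ((lam m : ℝ) + 1) := Finset.sum_nonneg fun m _ => by positivity
    refine ⟨|C₁| * ((∑ m, ((lam m : ℝ) + 1)) * (Bθ * B₁)) + |C₂| * (Bθ * B₁), by positivity,
      fun ψ D hψ hpt hs => ?_⟩
    have hG : ContDiffOn ℝ kI (vecRefApprox A ψ) (Icc (-1) 1) :=
      contDiffOn_vecRefApprox A (by rwa [max_comm])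
    have h1 : pointSum y lam (-1) 1 (vecRefApprox A ψ) + supNorm (Ioc (-1) 1) (vecRefApprox A ψ)
        ≤ B₁ * D := by
      have h1 := hA (-1) 1 h11 ψ hψ
      rw [locApprox_ref] at h1
      have h3 := mul_le_abs_mul (c := C₁') (pointSum_nonneg x κ h11 ψ) (pointSum_ref_le x κ ψ hpt)
      have h4 := mul_le_abs_mul (c := C₂') (supNorm_nonneg _ ψ) (hsup ψ D hs)
      refine h1.trans ((add_le_add h3 h4).trans (le_of_eq ?_))
      simp only [B₁]
      ring
    have hp := pointSum_nonneg y lam h11 (vecRefApprox A ψ)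
    have hq := supNorm_nonneg (Ioc (-1) 1) (vecRefApprox A ψ)
    have h2 := hI (-1) 1 h11 _ (contDiffOn_eval_smul θ hG)
    rw [vecLocInt_ref] at h2
    norm_num at h2
    have h3 : pointSum y lam (-1) 1 (fun s => θ.eval s • vecRefApprox A ψ s)
        ≤ (∑ m, ((lam m : ℝ) + 1)) * (Bθ * (B₁ * D)) :=
      pointSum_ref_le y lam _ fun m j hj => hθ d _ _ hG _ (hy m) j (hj.trans (hlam m))
        fun l hl => (norm_le_pointSum_ref y lam _ (hl.trans hj)).trans (by linarith)
    have h4 : supNorm (Ioc (-1) 1) (fun s => θ.eval s • vecRefApprox A ψ s) ≤ Bθ * (B₁ * D) := by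
      refine supNorm_le (nonempty_Ioc.2 h11) fun t ht => ?_
      have := hθ d _ (B₁ * D) hG t (Ioc_subset_Icc_self ht) 0 (Nat.zero_le _) fun l hl => by
        obtain rfl := Nat.le_zero.1 hl
        rw [iteratedDerivWithin_zero]
        exact (norm_le_supNorm_Ioc hG.continuousOn ht).trans (by linarith)
      simpa using this
    refine h2.trans ((add_le_add
      (mul_le_abs_mul (pointSum_nonneg _ _ h11 _) h3)
      (mul_le_abs_mul (supNorm_nonneg _ _) h4)).trans (le_of_eq ?_))
    ring

/-- Stability of the derivative of a discrete solution with respect to the right-hand side. -/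
theorem exists_refMatch_bound (hkr : k ≤ r) {Q : RefIntegrator kI} (hQ : AssUnisolvent r k Q)
    {A : RefApprox kA} (hQb : AssBounded d Q) {x : Fin (K + 1) → ℝ} {κ : Fin (K + 1) → ℕ}
    (hP : AssPointA d kI A x κ ∨ AssPointB d Q A x κ) : ∃ B : ℝ, 0 ≤ B ∧
    ∀ (ψ : ℝ → E d) (D : ℝ) (p : Fin d → ℝ[X]), ContDiffOn ℝ (max kI kA : ℕ) ψ (Icc (-1) 1) →
      (∀ c ∈ hermiteConds k x κ, ‖iteratedDerivWithin c.2 ψ (Icc (-1) 1) c.1‖ ≤ D) →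
      (∀ s ∈ Icc (-1 : ℝ) 1, ‖ψ s‖ ≤ D) → IsRefMatch r k Q A ψ p →
      (∀ s ∈ Icc (-1 : ℝ) 1, ‖vecEval p s‖ ≤ B * D) ∧ ‖vecRefInt Q (vecEval p)‖ ≤ B * D ∧
        ‖vecRefInt Q (vecRefApprox A ψ)‖ ≤ B * D := by
  obtain ⟨b, hb⟩ := exists_dual_family _ (refFunctional_separating hkr hQ)
  choose c hc using fun i => (isCompact_Icc (a := (-1 : ℝ)) (b := 1)).exists_bound_of_continuousOn
    (b i).continuous.continuousOn
  choose Bm hBm0 hBm using exists_bound_refInt_refApprox hQb hP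
  -- Weights of the data relative to `D`: derivatives at the endpoints are Hermite conditions and
  -- bounded by `D` itself, moments by `Bm` times `D`.
  let W : Fin (k / 2) ⊕ Fin ((k - 1) / 2) ⊕ Fin (r + 1 - max 1 k) → ℝ :=
    Sum.elim (fun _ => 1) <| Sum.elim (fun _ => 1) fun j => Bm (testPoly k j)
  have hW : ∀ i, 0 ≤ W i := by
    rintro (i | i | i)
    · exact zero_le_one
    · exact zero_le_one
    · exact hBm0 _
  have h1 : 0 ≤ ∑ i, |c i| * W i :=
    Finset.sum_nonneg fun i _ => mul_nonneg (abs_nonneg _) (hW i)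
  have h2 : 0 ≤ ∑ i, |Q.polyFun (b i)| * W i :=
    Finset.sum_nonneg fun i _ => mul_nonneg (abs_nonneg _) (hW i)
  refine ⟨∑ i, |c i| * W i + ∑ i, |Q.polyFun (b i)| * W i + Bm 1,
    add_nonneg (add_nonneg h1 h2) (hBm0 1), fun ψ D p hψ hcond hs hp => ?_⟩
  have hD : 0 ≤ D := (norm_nonneg _).trans (hs 0 (by simp))
  have hpt : ∀ m, ∀ j ≤ κ m, ‖iteratedDerivWithin j ψ (Icc (-1) 1) (x m)‖ ≤ D := fun m j hj =>
    hcond (x m, j) <| Finset.mem_union_right _ <| Finset.mem_biUnion.2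
      ⟨m, Finset.mem_univ _, Finset.mem_image.2 ⟨j, Finset.mem_range.2 (by lia), rfl⟩⟩
  have hL : ∀ i, ‖(WithLp.toLp 2 fun n => refFunctional r k Q i (p n) : E d)‖ ≤ W i * D := by
    rintro (i | i | i)
    · have h := hcond ((1 : ℝ), i) <| Finset.mem_union_left _ <| Finset.mem_union_left _ <|
        Finset.mem_image.2 ⟨i, Finset.mem_range.2 i.2, rfl⟩
      rw [← hp.right i i.2] at h
      simpa [refFunctional, W, vecEval] using h
    · have h := hcond ((-1 : ℝ), i) <| Finset.mem_union_left _ <| Finset.mem_union_right _ <|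
        Finset.mem_image.2 ⟨i, Finset.mem_range.2 i.2, rfl⟩
      rw [← hp.left i i.2] at h
      simpa [refFunctional, W, vecEval] using h
    · have h := hBm (testPoly k i) ψ D hψ hpt hs
      rw [← hp.moment i i.2] at h
      simpa [refFunctional, W, vecRefInt, RefIntegrator.polyFun_apply] using h
  -- This is used for evaluation at a point and for the integrator. The latter needs no continuity
  -- here, since its values on the fixed `b i` are just finitely many numbers.
  have key : ∀ F : ℝ[X] →ₗ[ℝ] ℝ, ∀ c' : _ → ℝ, (∀ i, |F (b i)| ≤ |c' i|) →
      ‖(WithLp.toLp 2 fun i => F (p i) : E d)‖ ≤ (∑ i, |c' i| * W i) * D := by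
    intro F c' hF
    refine (norm_vecEval_le_of_dual hb F hp.mem).trans ?_
    rw [Finset.sum_mul]
    refine Finset.sum_le_sum fun i _ => ?_
    rw [mul_assoc]
    exact mul_le_mul (hF i) (hL i) (norm_nonneg _) (abs_nonneg _)
  have hle : ∀ {u v : ℝ}, u ≤ v * D → v ≤ ∑ i, |c i| * W i + ∑ i, |Q.polyFun (b i)| * W i + Bm 1 →
      u ≤ (∑ i, |c i| * W i + ∑ i, |Q.polyFun (b i)| * W i + Bm 1) * D := fun h h' =>
    h.trans (mul_le_mul_of_nonneg_right h' hD)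
  have h3 := hBm0 1
  refine ⟨fun s hs' => ?_, ?_, ?_⟩
  · refine hle (key (leval s) c fun i => ?_) (by linarith)
    exact (hc i s hs').trans (le_abs_self _)
  · exact hle (key Q.polyFun (fun i => Q.polyFun (b i)) fun i => le_rfl) (by linarith)
  · have h := hBm 1 ψ D hψ hpt hs
    simp only [eval_one, one_smul] at h
    exact hle h (by linarith)

end ReferenceBounds

/-! ### Transformation of the local problems to the reference interval -/

section Transformation

open Polynomial

variable {d r k kI kA : ℕ} {a b : ℝ}

theorem aff_mem (hab : a < b) {s : ℝ} (hs : s ∈ Icc (-1 : ℝ) 1) : aff a b s ∈ Icc a b := by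
  obtain ⟨h1, h2⟩ := hs
  constructor <;> simp only [aff] <;> nlinarith

theorem aff_mem_Ioc (hab : a < b) {s : ℝ} (hs : s ∈ Ioc (-1 : ℝ) 1) : aff a b s ∈ Ioc a b := by
  obtain ⟨h1, h2⟩ := hs
  constructor <;> simp only [aff] <;> nlinarith

theorem aff_neg_one : aff a b (-1) = a := by simp only [aff]; ring

theorem aff_one : aff a b 1 = b := by simp only [aff]; ring

theorem aff_affInv (hab : a < b) (t : ℝ) : aff a b (affInv a b t) = t := by
  have : b - a ≠ 0 := (sub_pos.2 hab).ne'
  simp only [aff, affInv]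
  field_simp
  ring

theorem affInv_mem (hab : a < b) {t : ℝ} (ht : t ∈ Icc a b) : affInv a b t ∈ Icc (-1 : ℝ) 1 := by
  have h := sub_pos.2 hab
  obtain ⟨h1, h2⟩ := ht
  simp only [affInv]
  rw [mem_Icc, le_div_iff₀ h, div_le_iff₀ h]
  constructor <;> linarith

theorem affInv_eq (t : ℝ) : affInv a b t = -(b + a) / (b - a) + 2 / (b - a) * t := by
  simp only [affInv]
  ring

theorem hasDerivAt_aff (s : ℝ) : HasDerivAt (aff a b) ((b - a) / 2) s :=
  (((hasDerivAt_id s).const_mul ((b - a) / 2)).const_add ((b + a) / 2)).congr_deriv (mul_one _)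

theorem contDiff_aff {n : WithTop ℕ∞} : ContDiff ℝ n (aff a b) := by
  unfold aff
  fun_prop

theorem contDiffOn_comp_aff (hab : a < b) {n : WithTop ℕ∞} {g : ℝ → E d}
    (hg : ContDiffOn ℝ n g (Icc a b)) :
    ContDiffOn ℝ n (fun s => g (aff a b s)) (Icc (-1) 1) :=
  hg.comp contDiff_aff.contDiffOn fun _ hs => aff_mem hab hs

theorem iteratedDerivWithin_comp_aff (hab : a < b) {n i : ℕ} {g : ℝ → E d}
    (hg : ContDiffOn ℝ n g (Icc a b)) (hi : i ≤ n) {s : ℝ} (hs : s ∈ Icc (-1 : ℝ) 1) :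
    iteratedDerivWithin i (fun s => g (aff a b s)) (Icc (-1) 1) s
      = ((b - a) / 2) ^ i • iteratedDerivWithin i g (Icc a b) (aff a b s) := by
  induction i generalizing s with
  | zero => simp
  | succ i ih =>
    rw [iteratedDerivWithin_succ, iteratedDerivWithin_succ,
      derivWithin_congr (fun x hx => ih (by lia) hx) (ih (by lia) hs)]
    have h1 : HasDerivWithinAt (iteratedDerivWithin i g (Icc a b))
        (derivWithin (iteratedDerivWithin i g (Icc a b)) (Icc a b) (aff a b s)) (Icc a b)
        (aff a b s) :=
      (hg.differentiableOn_iteratedDerivWithin (by exact_mod_cast hi) (uniqueDiffOn_Icc hab) _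
        (aff_mem hab hs)).hasDerivWithinAt
    have h2 := (h1.scomp s (hasDerivAt_aff s).hasDerivWithinAt fun _ hx => aff_mem hab hx)
    have h3 := (h2.const_smul (((b - a) / 2) ^ i)).derivWithin (uniqueDiffOn_ref s hs)
    simp only [Function.comp_def] at h3
    erw [h3]
    rw [smul_smul, pow_succ]

theorem comp_affine_mem_degreeLT {n : ℕ} {p : ℝ[X]} (hp : p ∈ degreeLT ℝ n) (α β : ℝ) :
    p.comp (C α + C β * X) ∈ degreeLT ℝ n := by
  rcases n with _ | n
  · have : p = 0 := by
      have h : ∀ m, p.coeff m = 0 := by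
        simpa using (degree_lt_iff_coeff_zero _ _).1 (mem_degreeLT.1 hp)
      ext m; simp [h m]
    simp [this]
  · rw [mem_degreeLT_succ_iff] at hp ⊢
    exact (natDegree_comp_affine_le p α β).trans hp

theorem IsVecPoly.contDiff {s : ℕ} {v : ℝ → E d} (hv : IsVecPoly s v) {n : WithTop ℕ∞} :
    ContDiff ℝ n v := by
  obtain ⟨p, -, rfl⟩ := isVecPoly_iff.1 hv
  exact contDiff_vecEval p

theorem IsVecPoly.continuous {s : ℕ} {v : ℝ → E d} (hv : IsVecPoly s v) : Continuous v :=
  (hv.contDiff (n := 0)).continuous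

theorem IsVecPoly.differentiable {s : ℕ} {v : ℝ → E d} (hv : IsVecPoly s v) :
    Differentiable ℝ v :=
  (hv.contDiff (n := 1)).differentiable one_ne_zero

theorem IsVecPoly.exists_deriv_aff {V : ℝ → E d} (hV : IsVecPoly r V) (a b : ℝ) :
    ∃ p : Fin d → ℝ[X], (∀ i, p i ∈ degreeLT ℝ r) ∧ ∀ s, vecEval p s = deriv V (aff a b s) := by
  obtain ⟨P, hP, rfl⟩ := isVecPoly_iff.1 hV
  refine ⟨_, fun i => comp_affine_mem_degreeLT (derivative_mem_degreeLT (hP i)) ((b + a) / 2)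
    ((b - a) / 2), fun s => ?_⟩
  rw [deriv_vecEval, aff, vecEval_comp_affine]

/-- `p` represents `V' ∘ aff` without a chain-rule factor, so its derivatives carry the same power
of `(b - a) / 2` as those of `g ∘ aff`, and the scaling cancels in the matching conditions. -/
theorem vecEval_iterate_derivative_eq (hab : a < b) {V : ℝ → E d} (hV : IsVecPoly r V)
    {p : Fin d → ℝ[X]} (hp : ∀ s, vecEval p s = deriv V (aff a b s)) (i : ℕ) {s : ℝ}
    (hs : s ∈ Icc (-1 : ℝ) 1) :
    vecEval (fun n => derivative^[i] (p n)) s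
      = ((b - a) / 2) ^ i • iteratedDeriv (i + 1) V (aff a b s) := by
  have hV' : ContDiff ℝ i (deriv V) := by
    obtain ⟨P, -, rfl⟩ := isVecPoly_iff.1 hV
    rw [deriv_vecEval]
    exact contDiff_vecEval _
  rw [← iteratedDeriv_vecEval, iteratedDeriv_succ',
    ← iteratedDerivWithin_eq_iteratedDeriv uniqueDiffOn_ref (contDiff_vecEval p).contDiffAt hs,
    ← iteratedDerivWithin_eq_iteratedDeriv (uniqueDiffOn_Icc hab) hV'.contDiffAt (aff_mem hab hs),
    ← iteratedDerivWithin_comp_aff hab hV'.contDiffOn le_rfl hs]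
  exact iteratedDerivWithin_congr (fun x _ => hp x) hs

theorem RefIntegrator.map_zero (Q : RefIntegrator kI) : Q.toFun (fun _ => 0) = 0 := by
  simpa using Q.map_smul 0 (fun _ => 0) contDiffOn_const

theorem RefIntegrator.map_sum (Q : RefIntegrator kI) {ι : Type*} (S : Finset ι)
    (F : ι → ℝ → ℝ) (hF : ∀ i ∈ S, ContDiffOn ℝ kI (F i) (Icc (-1) 1)) :
    Q.toFun (fun x => ∑ i ∈ S, F i x) = ∑ i ∈ S, Q.toFun (F i) := by
  classical
  induction S using Finset.induction_on with
  | empty => simpa using Q.map_zero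
  | insert i S hi ih =>
    have h1 : ∀ j ∈ S, ContDiffOn ℝ kI (F j) (Icc (-1) 1) := fun j hj =>
      hF j (Finset.mem_insert_of_mem hj)
    simp only [Finset.sum_insert hi]
    rw [Q.map_add _ _ (hF i (Finset.mem_insert_self _ _)) (ContDiffOn.sum h1), ih h1]

/-- The moments of a function with respect to polynomials. -/
def moments (Q : RefIntegrator kI) (G : ℝ → E d) (hG : ContDiffOn ℝ kI G (Icc (-1) 1)) :
    ℝ[X] →ₗ[ℝ] E d where
  toFun θ := vecRefInt Q fun s => θ.eval s • G s
  map_add' p q := by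
    ext i
    simpa [vecRefInt, add_mul] using Q.map_add _ _
      (contDiffOn_apply (contDiffOn_eval_smul p hG) i)
      (contDiffOn_apply (contDiffOn_eval_smul q hG) i)
  map_smul' c p := by
    ext i
    simpa [vecRefInt, mul_assoc] using Q.map_smul c _
      (contDiffOn_apply (contDiffOn_eval_smul p hG) i)

theorem moments_apply (Q : RefIntegrator kI) (G : ℝ → E d)
    (hG : ContDiffOn ℝ kI G (Icc (-1) 1)) (θ : ℝ[X]) :
    moments Q G hG θ = vecRefInt Q fun s => θ.eval s • G s := rfl

theorem locInt_inner (Q : RefIntegrator kI) {F G φ : ℝ → E d}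
    (hG : ContDiffOn ℝ kI G (Icc (-1) 1)) (hFG : ∀ s, F (aff a b s) = G s)
    {θ : Fin d → ℝ[X]} (hφ : ∀ s, φ (aff a b s) = vecEval θ s) :
    locInt Q a b (fun t => inner ℝ (F t) (φ t)) = (b - a) / 2 * ∑ n, moments Q G hG (θ n) n := by
  have h : ∀ s, inner ℝ (F (aff a b s)) (φ (aff a b s)) = ∑ n, (θ n).eval s * G s n := by
    intro s
    rw [hφ, hFG, PiLp.inner_apply]
    rfl
  simp only [locInt, h]
  rw [Q.map_sum Finset.univ (fun n s => (θ n).eval s * G s n) fun n _ =>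
    contDiffOn_apply (contDiffOn_eval_smul (θ n) hG) n]
  rfl

/-- For `k ≥ 1` the test polynomials are the monomials. For `k = 0` they are multiples of `X + 1`,
and `θ = θ(-1) + (X + 1) ψ` shows that only the constant `1` is missing. -/
theorem linearMap_eq_zero_of_testPoly (hkr : k ≤ r) {F : Type*} [AddCommGroup F] [Module ℝ F]
    (N : ℝ[X] →ₗ[ℝ] F) (h : ∀ j < r + 1 - max 1 k, N (testPoly k j) = 0)
    (h0 : k = 0 → N 1 = 0) {θ : ℝ[X]} (hθ : θ.natDegree ≤ r - k) : N θ = 0 := by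
  have key : ∀ w : ℝ[X], (∀ j < r + 1 - max 1 k, N (w * X ^ j) = 0) →
      ∀ φ ∈ degreeLT ℝ (r + 1 - max 1 k), N (w * φ) = 0 := by
    intro w hw φ hφ
    have : φ ∈ LinearMap.ker (N ∘ₗ LinearMap.mulLeft ℝ w) := by
      rw [degreeLT_eq_span_X_pow] at hφ
      refine Submodule.span_le.2 ?_ hφ
      intro x hx
      obtain ⟨j, hj, rfl⟩ : ∃ j, j < r + 1 - max 1 k ∧ X ^ j = x := by simpa using hx
      simpa using hw j hj
    simpa using this
  rcases Nat.eq_zero_or_pos k with rfl | hk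
  · simp only [testPoly, if_true] at h
    obtain ⟨ψ, hψ⟩ : (X - C (-1)) ∣ θ - C (θ.eval (-1)) := by
      rw [dvd_iff_isRoot]; simp
    have hψd : ψ ∈ degreeLT ℝ (r + 1 - max 1 0) := by
      rcases eq_or_ne ψ 0 with rfl | hψ0
      · exact Submodule.zero_mem _
      have hd := congrArg natDegree hψ
      rw [natDegree_sub_C, (monic_X_sub_C _).natDegree_mul' hψ0, natDegree_X_sub_C] at hd
      rw [mem_degreeLT, ← natDegree_lt_iff_degree_lt hψ0]
      lia
    have h1 := key _ h ψ hψd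
    have h2 : θ = θ.eval (-1) • (1 : ℝ[X]) + (X + C 1) * ψ := by
      have : (X - C (-1) : ℝ[X]) = X + C 1 := by simp
      rw [← this, ← hψ, smul_eq_C_mul]
      ring
    rw [h2, map_add, map_smul, h0 rfl, h1]
    simp
  · have h1 := key 1 (fun j hj => by simpa [testPoly, hk.ne'] using h j hj) θ (by
      have : r + 1 - max 1 k = r - k + 1 := by lia
      rw [this, mem_degreeLT_succ_iff]; exact hθ)
    simpa using h1

/-- `V` is the result of one step of the method on `(a,b]` for the right-hand side `g` and the
incoming value `y₀`. -/
structure IsStep (r k : ℕ) (Q : RefIntegrator kI) (A : RefApprox kA) (a b : ℝ) (g : ℝ → E d)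
    (y₀ : E d) (V : ℝ → E d) : Prop where
  poly : IsVecPoly r V
  init : 1 ≤ k → V a = y₀
  right : ∀ i < k / 2, iteratedDeriv (i + 1) V b = iteratedDerivWithin i g (Icc a b) b
  left : ∀ i < (k - 1) / 2, iteratedDeriv (i + 1) V a = iteratedDerivWithin i g (Icc a b) a
  variational : ∀ φ : ℝ → E d, IsVecPoly (r - k) φ →
    locInt Q a b (fun t => inner ℝ (deriv V t) (φ t))
        + (if k = 0 then inner ℝ (V a - y₀) (φ a) else 0)
      = locInt Q a b (fun t => inner ℝ (locApprox A a b g t) (φ t))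

theorem isVecPoly_comp_affInv {s : ℕ} {θ : Fin d → ℝ[X]} (hθ : ∀ n, (θ n).natDegree ≤ s)
    (a b : ℝ) : IsVecPoly s fun t => vecEval θ (affInv a b t) := by
  simp only [affInv_eq]
  exact IsVecPoly.comp_affine (isVecPoly_iff.2 ⟨θ, hθ, rfl⟩) _ _

/-- The variational equation on `(a,b]` in terms of scalar test functions on `[-1,1]`. -/
theorem variational_iff (hab : a < b) {Q : RefIntegrator kI} {A : RefApprox kA} {g : ℝ → E d}
    {y₀ : E d} {V : ℝ → E d} {p : Fin d → ℝ[X]} (hp : ∀ s, vecEval p s = deriv V (aff a b s))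
    (hG : ContDiffOn ℝ kI (vecRefApprox A fun s => g (aff a b s)) (Icc (-1) 1)) :
    (∀ φ : ℝ → E d, IsVecPoly (r - k) φ →
      locInt Q a b (fun t => inner ℝ (deriv V t) (φ t))
          + (if k = 0 then inner ℝ (V a - y₀) (φ a) else 0)
        = locInt Q a b (fun t => inner ℝ (locApprox A a b g t) (φ t))) ↔
    ∀ θ : ℝ[X], θ.natDegree ≤ r - k →
      ((b - a) / 2) • moments Q (vecEval p) (contDiff_vecEval p).contDiffOn θ
          + (if k = 0 then θ.eval (-1) • (V a - y₀) else 0)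
        = ((b - a) / 2) • moments Q _ hG θ := by
  have h1 : ∀ {φ : ℝ → E d} {θ : Fin d → ℝ[X]}, (∀ s, φ (aff a b s) = vecEval θ s) →
      locInt Q a b (fun t => inner ℝ (deriv V t) (φ t)) = _ := fun hφ =>
    locInt_inner Q (contDiff_vecEval p).contDiffOn (fun s => (hp s).symm) hφ
  have h2 : ∀ {φ : ℝ → E d} {θ : Fin d → ℝ[X]}, (∀ s, φ (aff a b s) = vecEval θ s) →
      locInt Q a b (fun t => inner ℝ (locApprox A a b g t) (φ t)) = _ := fun hφ =>
    locInt_inner Q hG (fun s => locApprox_aff A hab g s) hφ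
  have h3 : ∀ {φ : ℝ → E d} {θ : Fin d → ℝ[X]}, (∀ s, φ (aff a b s) = vecEval θ s) →
      inner ℝ (V a - y₀) (φ a) = ∑ n, (θ n).eval (-1) * (V a - y₀) n := by
    intro φ θ hφ
    have := hφ (-1)
    rw [aff_neg_one] at this
    rw [this, PiLp.inner_apply]
    rfl
  constructor
  · intro h θ hθ
    ext n
    -- The test function with `θ` in component `n` and zeros elsewhere isolates that component.
    have hdeg : ∀ m, ((Pi.single n θ : Fin d → ℝ[X]) m).natDegree ≤ r - k := by
      intro m
      rcases eq_or_ne m n with rfl | hm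
      · simpa using hθ
      · simp [hm]
    have hφ : ∀ s, vecEval (Pi.single n θ) (affInv a b (aff a b s)) = vecEval (Pi.single n θ) s :=
      fun s => by rw [affInv_aff hab]
    have := h _ (isVecPoly_comp_affInv hdeg a b)
    have h3' := h3 (φ := fun t => vecEval (Pi.single n θ) (affInv a b t)) hφ
    beta_reduce at h3'
    rw [h1 hφ, h2 hφ, h3'] at this
    have hz : ∀ m, m ≠ n → (Pi.single n θ : Fin d → ℝ[X]) m = 0 := fun m hm => by simp [hm]
    rw [Finset.sum_eq_single n (fun m _ hm => by rw [hz m hm]; simp) (by simp),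
      Finset.sum_eq_single n (fun m _ hm => by rw [hz m hm]; simp) (by simp),
      Finset.sum_eq_single n (fun m _ hm => by rw [hz m hm]; simp) (by simp),
      Pi.single_eq_same] at this
    split_ifs at this ⊢ with hk
    · simpa using this
    · simpa using this
  · intro h φ hφ
    obtain ⟨θ, hθ, hφθ⟩ := isVecPoly_iff.1 (hφ.comp_affine ((b + a) / 2) ((b - a) / 2))
    have hφ' : ∀ s, φ (aff a b s) = vecEval θ s := fun s => congrFun hφθ s
    rw [h1 hφ', h2 hφ', h3 hφ', Finset.mul_sum, Finset.mul_sum]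
    have h4 : (if k = 0 then ∑ n, (θ n).eval (-1) * (V a - y₀) n else 0)
        = ∑ n, if k = 0 then (θ n).eval (-1) * (V a - y₀) n else 0 := by
      split_ifs <;> simp
    rw [h4, ← Finset.sum_add_distrib]
    refine Finset.sum_congr rfl fun n _ => ?_
    have := congrArg (fun v : E d => v n) (h (θ n) (hθ n))
    simp only [PiLp.add_apply, PiLp.smul_apply, smul_eq_mul] at this
    rw [← this]
    split_ifs <;> simp

theorem contDiffOn_refApprox_comp_aff (hab : a < b) (A : RefApprox kA) {g : ℝ → E d}
    (hg : ContDiffOn ℝ (kJ k kI kA) g (Icc a b)) :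
    ContDiffOn ℝ kI (vecRefApprox A fun s => g (aff a b s)) (Icc (-1) 1) := by
  refine contDiffOn_vecRefApprox A ((contDiffOn_comp_aff hab hg).of_le ?_)
  have : max kA kI ≤ kJ k kI kA := by simp only [kJ]; lia
  exact_mod_cast this

/-- For `k = 0` the test polynomials vanish at `-1`, so the jump drops out and a closed problem for
`V'` remains; testing with `1` then recovers the jump. -/
theorem IsStep.isRefMatch (hkr : k ≤ r) (hab : a < b) {Q : RefIntegrator kI} {A : RefApprox kA}
    {g : ℝ → E d} (hg : ContDiffOn ℝ (kJ k kI kA) g (Icc a b)) {y₀ : E d} {V : ℝ → E d}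
    (hV : IsStep r k Q A a b g y₀ V) {p : Fin d → ℝ[X]} (hpr : ∀ i, p i ∈ degreeLT ℝ r)
    (hp : ∀ s, vecEval p s = deriv V (aff a b s)) :
    IsRefMatch r k Q A (fun s => g (aff a b s)) p ∧
      (k = 0 → V a - y₀ = ((b - a) / 2) •
        (vecRefInt Q (vecRefApprox A fun s => g (aff a b s)) - vecRefInt Q (vecEval p))) := by
  have hτ : (b - a) / 2 ≠ 0 := (by linarith : 0 < (b - a) / 2).ne'
  have hkJ : k / 2 - 1 ≤ kJ k kI kA := le_max_left _ _
  have hv := (variational_iff hab hp (contDiffOn_refApprox_comp_aff hab A hg)).1 hV.variational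
  refine ⟨⟨hpr, fun i hi => ?_, fun i hi => ?_, fun j hj => ?_⟩, fun hk => ?_⟩
  · rw [vecEval_iterate_derivative_eq hab hV.poly hp i (by simp),
      iteratedDerivWithin_comp_aff hab hg (by lia) (by simp), aff_one, hV.right i hi]
  · rw [vecEval_iterate_derivative_eq hab hV.poly hp i (by simp),
      iteratedDerivWithin_comp_aff hab hg (by lia) (by simp), aff_neg_one, hV.left i hi]
  · have h := hv _ (natDegree_testPoly_le hkr hj)
    have h0 : (if k = 0 then (testPoly k j).eval (-1) • (V a - y₀) else 0) = 0 := by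
      split_ifs with hk
      · simp [testPoly, hk]
      · rfl
    rw [h0, add_zero] at h
    exact smul_right_injective _ hτ h
  · have h := hv 1 (by simp)
    simp only [hk, if_true, eval_one, one_smul, moments_apply] at h
    rw [smul_sub, ← h]
    abel

theorem exists_isStep (hkr : k ≤ r) (hab : a < b) {Q : RefIntegrator kI}
    (hQ : AssUnisolvent r k Q) (A : RefApprox kA) {g : ℝ → E d}
    (hg : ContDiffOn ℝ (kJ k kI kA) g (Icc a b)) (y₀ : E d) :
    ∃ V, IsStep r k Q A a b g y₀ V := by
  have hτ : 0 < (b - a) / 2 := by linarith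
  have hba : b - a ≠ 0 := (sub_pos.2 hab).ne'
  have hkJ : k / 2 - 1 ≤ kJ k kI kA := le_max_left _ _
  obtain ⟨p, hp⟩ := exists_isRefMatch hkr hQ A fun s => g (aff a b s)
  have hG := contDiffOn_refApprox_comp_aff hab A hg
  -- For `k = 0` the value at `a` is not prescribed; it is chosen so that the equation tested with
  -- `1` holds.
  let c : E d := if k = 0 then y₀ + ((b - a) / 2) •
    (vecRefInt Q (vecRefApprox A fun s => g (aff a b s)) - vecRefInt Q (vecEval p)) else y₀
  choose P hPr hPp hPc using fun i => exists_derivative_eq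
    (Submodule.smul_mem _ ((b - a) / 2) (hp.mem i)) (-1) (c i)
  let V : ℝ → E d := fun t => vecEval P (affInv a b t)
  have hVa : V a = c := by
    ext i
    have : affInv a b a = -1 := by rw [← affInv_aff hab (-1), aff_neg_one]
    simp [V, this, hPc]
  have hVp : ∀ s, vecEval p s = deriv V (aff a b s) := by
    intro s
    have h1 : HasDerivAt (affInv a b) (2 / (b - a)) (aff a b s) := by
      have : affInv a b = fun t => -(b + a) / (b - a) + 2 / (b - a) * t := funext affInv_eq
      rw [this]
      simpa using ((hasDerivAt_id (aff a b s)).const_mul (2 / (b - a))).const_add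
        (-(b + a) / (b - a))
    have h2 := ((hasDerivAt_vecEval P _).scomp _ h1).deriv
    refine Eq.trans ?_ h2.symm
    rw [affInv_aff hab]
    ext i
    simp only [hPp, PiLp.smul_apply, vecEval_apply, eval_smul, smul_eq_mul]
    field_simp
  have hVpoly : IsVecPoly r V := isVecPoly_comp_affInv hPr a b
  refine ⟨V, hVpoly, fun hk => ?_, fun i hi => ?_, fun i hi => ?_, ?_⟩
  · rw [hVa]
    simp only [c]
    rw [if_neg (by lia)]
  · have h := hp.right i hi
    rw [vecEval_iterate_derivative_eq hab hVpoly hVp i (by simp),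
      iteratedDerivWithin_comp_aff hab hg (by lia) (by simp), aff_one] at h
    exact smul_right_injective _ (pow_ne_zero i hτ.ne') h
  · have h := hp.left i hi
    rw [vecEval_iterate_derivative_eq hab hVpoly hVp i (by simp),
      iteratedDerivWithin_comp_aff hab hg (by lia) (by simp), aff_neg_one] at h
    exact smul_right_injective _ (pow_ne_zero i hτ.ne') h
  · refine (variational_iff hab hVp hG).2 fun θ hθ => ?_
    -- The residual of the variational equation, as a linear function of the test polynomial.
    let N : ℝ[X] →ₗ[ℝ] E d :=
      ((b - a) / 2) • (moments Q (vecEval p) (contDiff_vecEval p).contDiffOn - moments Q _ hG)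
        + if k = 0 then (leval (-1)).smulRight (V a - y₀) else 0
    have hN : ∀ θ : ℝ[X], N θ = (((b - a) / 2) • moments Q (vecEval p)
        (contDiff_vecEval p).contDiffOn θ + (if k = 0 then θ.eval (-1) • (V a - y₀) else 0))
        - ((b - a) / 2) • moments Q _ hG θ := by
      intro θ
      simp only [N]
      split_ifs
      · simp [smul_sub, leval_apply]; abel
      · simp [smul_sub]
    have h0 : N θ = 0 := by
      refine linearMap_eq_zero_of_testPoly hkr N (fun j hj => ?_) (fun hk => ?_) hθ
      · have h1 : (if k = 0 then (testPoly k j).eval (-1) • (V a - y₀) else 0) = 0 := by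
          split_ifs with hk
          · simp [testPoly, hk]
          · rfl
        rw [hN, h1, add_zero, moments_apply, moments_apply, hp.moment j hj, sub_self]
      · rw [hN, hVa]
        simp only [moments_apply, c, hk, if_true, eval_one, one_smul, smul_sub]
        abel
    rw [hN, sub_eq_zero] at h0
    exact h0

end Transformation

/-! ### Smoothness of the solution and existence of the approximation operators -/

section Operators

open Polynomial

variable {d r k kI kA K : ℕ}

theorem contDiffOn_rhs {n : WithTop ℕ∞} {f : ℝ → E d → E d} {s : Set ℝ}
    (hf : ContDiffOn ℝ n (fun p : ℝ × E d => f p.1 p.2) (s ×ˢ univ)) {v : ℝ → E d}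
    (hv : ContDiffOn ℝ n v s) : ContDiffOn ℝ n (fun t => f t (v t)) s :=
  hf.comp (contDiffOn_id.prodMk hv) fun _ ht => ⟨ht, mem_univ _⟩

/-- Bootstrapping: each order of smoothness of `u` passes through `f` to `u'`, ending one order
above that of `f`. -/
theorem contDiffOn_solution {q : ℕ} {f : ℝ → E d → E d} {s : Set ℝ} (hs : UniqueDiffOn ℝ s)
    (hf : ContDiffOn ℝ q (fun p : ℝ × E d => f p.1 p.2) (s ×ˢ univ)) {u : ℝ → E d}
    (hu : ∀ t ∈ s, HasDerivWithinAt u (f t (u t)) s t) :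
    ContDiffOn ℝ (q + 1 : ℕ) u s := by
  suffices h : ∀ m ≤ q + 1, ContDiffOn ℝ m u s from h _ le_rfl
  intro m
  induction m with
  | zero =>
    intro _
    exact contDiffOn_zero.2 fun t ht => (hu t ht).continuousWithinAt
  | succ m ih =>
    intro hm
    push_cast
    refine (contDiffOn_succ_iff_derivWithin hs).2
      ⟨fun t ht => (hu t ht).differentiableWithinAt, by simp, ?_⟩
    exact (contDiffOn_rhs (hf.of_le (by exact_mod_cast (by lia : m ≤ q))) (ih (by lia))).congr
      fun t ht => (hu t ht).derivWithin (hs t ht)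

theorem iteratedDerivWithin_subset {n : ℕ} {s t : Set ℝ} (hst : s ⊆ t) (hs : UniqueDiffOn ℝ s)
    (ht : UniqueDiffOn ℝ t) {g : ℝ → E d} (hg : ContDiffOn ℝ n g t) {x : ℝ} (hx : x ∈ s) :
    iteratedDerivWithin n g s x = iteratedDerivWithin n g t x := by
  simp only [iteratedDerivWithin]
  rw [iteratedFDerivWithin_subset hst hs ht hg hx]

/-- The inequality says that the continuous functions `max F G` and `G` agree almost everywhere,
hence everywhere. -/
theorem forall_le_of_ae_le {a b : ℝ} (hab : a < b) {F G : ℝ → ℝ}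
    (hF : ContinuousOn F (Icc a b)) (hG : ContinuousOn G (Icc a b))
    (h : ∀ᵐ s ∂(volume.restrict (Icc a b)), F s ≤ G s) : ∀ s ∈ Icc a b, F s ≤ G s := by
  have h1 := Measure.eqOn_Icc_of_ae_eq volume hab.ne (f := fun s => max (F s) (G s)) (g := G)
    (by filter_upwards [h] with s hs using max_eq_right hs) (hF.sup hG) hG
  intro s hs
  exact max_eq_right_iff.1 (h1 hs)

/-- Assumption 4 holds almost everywhere and for curves smooth on the whole time interval, whereas
pointwise bounds on a single cell are needed. The discrete solution may jump and is not such a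
curve, but the polynomial of one cell, extended beyond it, is. -/
theorem AssDiff.forall_le {q : ℕ} {f : ℝ → E d → E d} {t₀ T C₂ : ℝ} (hT : 0 < T)
    (hf : ContDiffOn ℝ q (fun p : ℝ × E d => f p.1 p.2) (Icc t₀ (t₀ + T) ×ˢ univ))
    (h : AssDiff q f t₀ T C₂) {v w : ℝ → E d}
    (hv : ContDiffOn ℝ (q + 1 : ℕ) v (Icc t₀ (t₀ + T)))
    (hw : ContDiffOn ℝ (q + 1 : ℕ) w (Icc t₀ (t₀ + T)))
    {a b : ℝ} (hab : a < b) (hsub : Icc a b ⊆ Icc t₀ (t₀ + T)) {i : ℕ} (hi : i ≤ q) {s : ℝ}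
    (hs : s ∈ Icc a b) :
    ‖iteratedDerivWithin i (fun t => f t (v t) - f t (w t)) (Icc a b) s‖
      ≤ C₂ * ∑ l ∈ Finset.range (i + 1),
        ‖iteratedDerivWithin l (fun t => v t - w t) (Icc a b) s‖ := by
  have hle : ∀ {m n : ℕ}, m ≤ n → (m : WithTop ℕ∞) ≤ n := fun h => by exact_mod_cast h
  have hT' : t₀ < t₀ + T := by linarith
  have hU := uniqueDiffOn_Icc hT'
  have hg : ContDiffOn ℝ q (fun t => f t (v t) - f t (w t)) (Icc t₀ (t₀ + T)) :=
    (contDiffOn_rhs hf (hv.of_le (hle (Nat.le_succ q)))).sub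
      (contDiffOn_rhs hf (hw.of_le (hle (Nat.le_succ q))))
  have hvw : ContDiffOn ℝ (q + 1 : ℕ) (fun t => v t - w t) (Icc t₀ (t₀ + T)) := hv.sub hw
  have key := forall_le_of_ae_le hT'
    (hg.continuousOn_iteratedDerivWithin (hle hi) hU).norm
    (continuousOn_const.mul <| continuousOn_finsetSum _ fun l hl =>
      (hvw.continuousOn_iteratedDerivWithin (hle (by
        have := Finset.mem_range.1 hl
        lia)) hU).norm) (h i hi v w hv hw) s (hsub hs)
  have hI := uniqueDiffOn_Icc hab
  rw [iteratedDerivWithin_subset hsub hI hU (hg.of_le (hle hi)) hs]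
  refine key.trans (le_of_eq ?_)
  refine congrArg (C₂ * ·) (Finset.sum_congr rfl fun l hl => ?_)
  have := Finset.mem_range.1 hl
  rw [iteratedDerivWithin_subset hsub hI hU (hvw.of_le (hle (by lia))) hs]

/-- The conditions on `𝒥u` are those of a step with right-hand side `u'` and incoming value `u a`.
Existence is enough for the `Classical.epsilon` choice; uniqueness plays no role. -/
theorem isJ_opJ (hkr : k ≤ r) {a b : ℝ} (hab : a < b) {Q : RefIntegrator kI}
    (hQ : AssUnisolvent r k Q) (A : RefApprox kA) {u : ℝ → E d}
    (hu : ContDiffOn ℝ (kJ k kI kA + 1 : ℕ) u (Icc a b)) :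
    IsJ r k Q A a b u (opJ r k Q A a b u) := by
  refine Classical.epsilon_spec (p := fun w => IsJ r k Q A a b u w) ?_
  have hg : ContDiffOn ℝ (kJ k kI kA) (derivWithin u (Icc a b)) (Icc a b) := by
    refine ((contDiffOn_succ_iff_derivWithin (uniqueDiffOn_Icc hab)).1 ?_).2.2
    exact_mod_cast hu
  obtain ⟨V, hV⟩ := exists_isStep hkr hab hQ A hg (u a)
  refine ⟨V, hV.poly, fun hk i hi => ?_, fun i hi => ?_, fun φ hφ => ?_⟩
  · rcases i with _ | i
    · simpa using hV.init hk
    · rw [hV.left i (by lia), iteratedDerivWithin_succ']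
  · obtain ⟨h1, h2⟩ := Finset.mem_Icc.1 hi
    obtain ⟨i, rfl⟩ := Nat.exists_eq_succ_of_ne_zero (by lia : i ≠ 0)
    rw [hV.right i (by lia), iteratedDerivWithin_succ']
  · rw [← hV.variational φ hφ]
    split_ifs
    · rw [inner_sub_left]; ring
    · ring

/-- Applied with `g = f(·,u)`, this puts `𝒥u` into the same form as the discrete solution. -/
theorem IsJ.isStep {a b : ℝ} {Q : RefIntegrator kI} {A : RefApprox kA}
    (hab : a < b) {u w g : ℝ → E d} (hw : IsJ r k Q A a b u w)
    (hg : EqOn (derivWithin u (Icc a b)) g (Icc a b)) : IsStep r k Q A a b g (u a) w := by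
  have hd : ∀ i, EqOn (iteratedDerivWithin (i + 1) u (Icc a b)) (iteratedDerivWithin i g (Icc a b))
      (Icc a b) := by
    intro i
    rw [iteratedDerivWithin_succ']
    exact iteratedDerivWithin_congr hg
  refine ⟨hw.poly, fun hk => ?_, fun i hi => ?_, fun i hi => ?_, fun φ hφ => ?_⟩
  · simpa using hw.left hk 0 (Nat.zero_le _)
  · rw [hw.right (i + 1) (Finset.mem_Icc.2 ⟨by lia, by lia⟩), hd i (right_mem_Icc.2 hab.le)]
  · rw [hw.left (by lia) (i + 1) (by lia), hd i (left_mem_Icc.2 hab.le)]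
  · have h := hw.variational φ hφ
    have h1 : locInt Q a b (fun t => inner ℝ (locApprox A a b (derivWithin u (Icc a b)) t) (φ t))
        = locInt Q a b (fun t => inner ℝ (locApprox A a b g t) (φ t)) := by
      simp only [locInt, locApprox_aff A hab]
      congr 1
      refine Q.congr_on _ _ fun s hs => ?_
      simp only [vecRefApprox_congr A (fun x hx => hg (aff_mem hab hx)) hs]
    rw [h1] at h
    split_ifs at h ⊢
    · rw [inner_sub_left]; linarith
    · simpa using h

theorem IsLocalSolution.isStep {a b : ℝ} {Q : RefIntegrator kI} {A : RefApprox kA}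
    {f : ℝ → E d → E d} {y₀ : E d} {V : ℝ → E d} (hV : IsLocalSolution r k Q A f a b y₀ V) :
    IsStep r k Q A a b (fun t => f t (V t)) y₀ V :=
  ⟨hV.poly, hV.init, hV.deriv_right, hV.deriv_left, hV.variational⟩

theorem mem_hermiteConds {x : Fin (K + 1) → ℝ} {κ : Fin (K + 1) → ℕ} {c : ℝ × ℕ} :
    c ∈ hermiteConds k x κ ↔ (c.1 = 1 ∧ c.2 < k / 2) ∨ (c.1 = -1 ∧ c.2 < (k - 1) / 2) ∨
      ∃ m, c.1 = x m ∧ c.2 ≤ κ m := by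
  obtain ⟨z, l⟩ := c
  simp only [hermiteConds, Finset.mem_union, Finset.mem_image, Finset.mem_range,
    Finset.mem_biUnion, Finset.mem_univ, true_and, Prod.mk.injEq, or_assoc]
  grind

theorem exists_isApp {x : Fin (K + 1) → ℝ} {κ : Fin (K + 1) → ℕ} {X : Finset ℝ}
    (hX : IsExtra r k x κ X) {a b : ℝ} (hab : a < b) (v : ℝ → E d) :
    IsApp r k x κ X a b v (opApp r k x κ X a b v) := by
  classical
  refine Classical.epsilon_spec (p := fun w => IsApp r k x κ X a b v w) ?_
  obtain ⟨hXc, hXm⟩ := hX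
  set S := hermiteConds k x κ with hSdef
  let S' := S ∪ X.image fun z => (z, 0)
  have hdisj : Disjoint S (X.image fun z => (z, 0)) := by
    rw [Finset.disjoint_right]
    intro c hc hcS
    obtain ⟨z, hz, rfl⟩ := Finset.mem_image.1 hc
    obtain ⟨⟨h1, h2⟩, h3⟩ := hXm z hz
    rcases mem_hermiteConds.1 hcS with ⟨h, -⟩ | ⟨h, -⟩ | ⟨m, h, -⟩
    · exact h2.ne h
    · exact h1.ne' h
    · exact h3 m h
  have hlow : ∀ c ∈ S', ∀ l ≤ c.2, (c.1, l) ∈ S' := by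
    intro c hc l hl
    rcases Finset.mem_union.1 hc with hc | hc
    · refine Finset.mem_union_left _ ?_
      rw [mem_hermiteConds] at hc ⊢
      grind
    · obtain ⟨z, hz, rfl⟩ := Finset.mem_image.1 hc
      obtain rfl := Nat.le_zero.1 hl
      exact Finset.mem_union_right _ hc
  -- At least one condition is present, so the truncated `rApp k x κ - 1` loses nothing.
  have hpos : 0 < S.card := Finset.card_pos.2 ⟨(x 0, 0), mem_hermiteConds.2
    (Or.inr (Or.inr ⟨0, rfl, Nat.zero_le _⟩))⟩
  have hcard : S'.card = max (rApp k x κ - 1) r + 1 := by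
    rw [Finset.card_union_of_disjoint hdisj, Finset.card_image_of_injective _
      (fun _ _ h => congrArg Prod.fst h), hXc]
    simp only [rApp, ← hSdef]
    lia
  choose q hq hqc using fun i : Fin d => exists_hermite hlow fun c =>
    ((b - a) / 2) ^ c.2 * iteratedDerivWithin c.2 v (Icc a b) (aff a b c.1) i
  have hqd : ∀ i, (q i).natDegree ≤ max (rApp k x κ - 1) r := fun i => by
    rw [← mem_degreeLT_succ_iff, ← hcard]; exact hq i
  have hw := isVecPoly_comp_affInv hqd a b
  have hcond : ∀ c ∈ S', iteratedDeriv c.2 (fun t => vecEval q (affInv a b t)) (aff a b c.1)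
      = iteratedDerivWithin c.2 v (Icc a b) (aff a b c.1) := by
    intro c hc
    have h1 : iteratedDeriv c.2 (fun t => vecEval q (affInv a b t)) (aff a b c.1)
        = (2 / (b - a)) ^ c.2 • vecEval (fun i => derivative^[c.2] (q i)) c.1 := by
      let F : ℝ → E d := fun y => vecEval q (2 / (b - a) * y)
      have e : (fun t => vecEval q (affInv a b t))
          = fun t => F (t + -(b + a) / 2) := by
        funext t
        simp only [F]
        congr 1
        simp only [affInv]
        have : b - a ≠ 0 := (sub_pos.2 hab).ne'
        field_simp
        ring
      rw [e, iteratedDeriv_comp_add_const c.2 F (-(b + a) / 2)]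
      have h2 := congrFun (iteratedDeriv_comp_const_smul (n := c.2) (contDiff_vecEval q)
        (2 / (b - a))) (aff a b c.1 + -(b + a) / 2)
      beta_reduce
      rw [show F = fun y => vecEval q (2 / (b - a) * y) from rfl, h2, iteratedDeriv_vecEval]
      congr 2
      have : b - a ≠ 0 := (sub_pos.2 hab).ne'
      simp only [aff]
      field_simp
      ring
    rw [h1]
    ext i
    simp only [PiLp.smul_apply, vecEval_apply, smul_eq_mul]
    rw [hqc i c hc, ← mul_assoc, ← mul_pow]
    have : 2 / (b - a) * ((b - a) / 2) = 1 := by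
      have : b - a ≠ 0 := (sub_pos.2 hab).ne'
      field_simp
    rw [this, one_pow, one_mul]
  refine ⟨_, hw, fun c hc => hcond c (Finset.mem_union_left _ hc), fun z hz => ?_⟩
  have := hcond (z, 0) (Finset.mem_union_right _ (Finset.mem_image_of_mem _ hz))
  simpa using this

end Operators

/-! ### Local error estimates -/

section LocalError

open Polynomial

variable {d r k kI kA K : ℕ}

/-- Derivatives of the composition of the right-hand side with the discrete and the exact solution
are controlled by the values of the discrete solution minus the Hermite interpolant. -/
theorem exists_rhs_diff_bound (r k : ℕ) {kI kA : ℕ} {x : Fin (K + 1) → ℝ}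
    (hx : ∀ m, x m ∈ Icc (-1 : ℝ) 1) {κ : Fin (K + 1) → ℕ} (hκ : ∀ m, κ m ≤ max kI kA)
    {X : Finset ℝ} (hX : IsExtra r k x κ X) : ∃ B : ℝ, 1 ≤ B ∧
    ∀ (d : ℕ) (g v u : ℝ → E d) (a b C₂ Z : ℝ), a < b → b - a ≤ 1 → 0 ≤ C₂ →
      ContDiffOn ℝ (kJ k kI kA) g (Icc a b) → ContDiffOn ℝ (kJ k kI kA + 1 : ℕ) u (Icc a b) →
      IsVecPoly r v →
      (∀ i ≤ kJ k kI kA, ∀ s ∈ Icc a b, ‖iteratedDerivWithin i g (Icc a b) s‖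
        ≤ C₂ * ∑ l ∈ Finset.range (i + 1),
          ‖iteratedDerivWithin l (fun t => v t - u t) (Icc a b) s‖) →
      (∀ s ∈ Ioc a b, ‖v s - opApp r k x κ X a b u s‖ ≤ Z) →
      ∀ c ∈ hermiteConds k x κ,
        ‖iteratedDerivWithin c.2 (fun s => g (aff a b s)) (Icc (-1) 1) c.1‖ ≤ B * (C₂ * Z) := by
  set R := max (rApp k x κ - 1) r with hR
  choose Bi hBi0 hBi using exists_inverse_inequality (R + 1)
  have hsum0 : ∀ c : ℝ × ℕ, 0 ≤ ∑ l ∈ Finset.range (c.2 + 1), Bi l c.1 := fun c =>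
    Finset.sum_nonneg fun l _ => hBi0 l c.1
  -- The summand `1` allows the same constant to serve for the supremum of `g` later on.
  refine ⟨1 + ∑ c ∈ hermiteConds k x κ, ∑ l ∈ Finset.range (c.2 + 1), Bi l c.1,
    le_add_of_nonneg_right (Finset.sum_nonneg fun c _ => hsum0 c), ?_⟩
  intro d g v u a b C₂ Z hab hτ hC₂ hg hu hv hlip hZ c hc
  have hZ0 : 0 ≤ Z := (norm_nonneg _).trans (hZ b (right_mem_Ioc.2 hab))
  have hI := uniqueDiffOn_Icc hab
  have hτ0 : 0 < (b - a) / 2 := by linarith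
  have hcR : c.1 ∈ Icc (-1 : ℝ) 1 := by
    rcases mem_hermiteConds.1 hc with ⟨h, -⟩ | ⟨h, -⟩ | ⟨m, h, -⟩
    · simp [h]
    · simp [h]
    · exact h ▸ hx m
  have hcJ : c.2 ≤ kJ k kI kA := by
    rcases mem_hermiteConds.1 hc with ⟨-, h⟩ | ⟨-, h⟩ | ⟨m, -, h⟩
    · simp only [kJ]; lia
    · simp only [kJ]; lia
    · have := hκ m
      simp only [kJ]; lia
  have hclow : ∀ l ≤ c.2, (c.1, l) ∈ hermiteConds k x κ := by
    intro l hl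
    rw [mem_hermiteConds] at hc ⊢
    grind
  obtain ⟨hAp, hAc, -⟩ := exists_isApp hX hab u
  set w := opApp r k x κ X a b u
  obtain ⟨pv, hpv, hpv'⟩ := isVecPoly_iff.1 (hv.comp_affine ((b + a) / 2) ((b - a) / 2))
  obtain ⟨pw, hpw, hpw'⟩ := isVecPoly_iff.1 (hAp.comp_affine ((b + a) / 2) ((b - a) / 2))
  have hz : ∀ s, v (aff a b s) - w (aff a b s) = vecEval (fun i => pv i - pw i) s := by
    intro s
    have h1 : v (aff a b s) = vecEval pv s := congrFun hpv' s
    have h2 : w (aff a b s) = vecEval pw s := congrFun hpw' s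
    rw [h1, h2]
    ext i
    simp
  have hzd : ∀ i, pv i - pw i ∈ degreeLT ℝ (R + 1) := fun i =>
    Submodule.sub_mem _ (mem_degreeLT_succ_iff.2 ((hpv i).trans (le_max_right _ _)))
      (mem_degreeLT_succ_iff.2 (hpw i))
  have hcm := aff_mem hab hcR
  have hl : ∀ l ≤ c.2, ((b - a) / 2) ^ c.2 *
      ‖iteratedDerivWithin l (fun t => v t - u t) (Icc a b) (aff a b c.1)‖ ≤ Bi l c.1 * Z := by
    intro l hl
    have hvl : ContDiffWithinAt ℝ l v (Icc a b) (aff a b c.1) := hv.contDiff.contDiffWithinAt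
    have hwl : ContDiffWithinAt ℝ l w (Icc a b) (aff a b c.1) := hAp.contDiff.contDiffWithinAt
    have hul : ContDiffWithinAt ℝ l u (Icc a b) (aff a b c.1) :=
      (hu _ hcm).of_le (by exact_mod_cast (by lia : l ≤ kJ k kI kA + 1))
    -- At a Hermite point `u` may be exchanged for its interpolant `w`, and `v - w` is a polynomial.
    have h1 : iteratedDerivWithin l (fun t => v t - u t) (Icc a b) (aff a b c.1)
        = iteratedDerivWithin l (fun t => v t - w t) (Icc a b) (aff a b c.1) := by
      have e1 := iteratedDerivWithin_sub hcm hI hvl hul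
      have e2 := iteratedDerivWithin_sub hcm hI hvl hwl
      have e3 := hAc _ (hclow l hl)
      simp only at e3
      rw [← iteratedDerivWithin_eq_iteratedDeriv hI hAp.contDiff.contDiffAt hcm] at e3
      rw [e3] at e2
      exact e1.trans e2.symm
    have h2 := iteratedDerivWithin_comp_aff hab
      ((hv.contDiff (n := l)).sub (hAp.contDiff (n := l))).contDiffOn le_rfl hcR
    have h3 : iteratedDerivWithin l (fun s => v (aff a b s) - w (aff a b s)) (Icc (-1) 1) c.1
        = vecEval (fun i => derivative^[l] (pv i - pw i)) c.1 := by
      rw [← iteratedDeriv_vecEval, ← iteratedDerivWithin_eq_iteratedDeriv uniqueDiffOn_ref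
        (contDiff_vecEval _).contDiffAt hcR]
      exact iteratedDerivWithin_congr (fun s _ => hz s) hcR
    have h4 := hBi l c.1 d _ Z hzd fun s hs => by
      rw [← hz]; exact hZ _ (aff_mem_Ioc hab hs)
    rw [← h3, h2, norm_smul, Real.norm_of_nonneg (by positivity)] at h4
    rw [h1]
    -- The inverse inequality provides the power `l` of `(b - a) / 2 ≤ 1`, which dominates the power
    -- `c.2 ≥ l`.
    refine le_trans ?_ h4
    gcongr ?_ * _
    exact pow_le_pow_of_le_one hτ0.le (by linarith) hl
  rw [iteratedDerivWithin_comp_aff hab hg hcJ hcR, norm_smul, Real.norm_of_nonneg (by positivity)]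
  calc ((b - a) / 2) ^ c.2 * ‖iteratedDerivWithin c.2 g (Icc a b) (aff a b c.1)‖
      ≤ ((b - a) / 2) ^ c.2 * (C₂ * ∑ l ∈ Finset.range (c.2 + 1),
          ‖iteratedDerivWithin l (fun t => v t - u t) (Icc a b) (aff a b c.1)‖) := by
        gcongr
        exact hlip _ hcJ _ hcm
    _ = C₂ * ∑ l ∈ Finset.range (c.2 + 1), ((b - a) / 2) ^ c.2 *
          ‖iteratedDerivWithin l (fun t => v t - u t) (Icc a b) (aff a b c.1)‖ := by
        rw [← Finset.mul_sum]; ring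
    _ ≤ C₂ * ∑ l ∈ Finset.range (c.2 + 1), Bi l c.1 * Z := by
        refine mul_le_mul_of_nonneg_left (Finset.sum_le_sum fun l hl' => hl l ?_) hC₂
        have := Finset.mem_range.1 hl'
        lia
    _ = (∑ l ∈ Finset.range (c.2 + 1), Bi l c.1) * (C₂ * Z) := by
        rw [← Finset.sum_mul]; ring
    _ ≤ _ := by
        gcongr
        refine (Finset.single_le_sum (f := fun c : ℝ × ℕ => ∑ l ∈ Finset.range (c.2 + 1), Bi l c.1)
          (fun c _ => hsum0 c) hc).trans ?_
        linarith

/-- Two results of one step with different right-hand sides and incoming values. -/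
theorem IsStep.jump_sub_eq (hkr : k ≤ r) {a b : ℝ} (hab : a < b) {Q : RefIntegrator kI}
    {A : RefApprox kA} {g h : ℝ → E d} (hg : ContDiffOn ℝ (kJ k kI kA) g (Icc a b))
    (hh : ContDiffOn ℝ (kJ k kI kA) h (Icc a b)) {y z : E d} {V W : ℝ → E d}
    (hV : IsStep r k Q A a b g y V) (hW : IsStep r k Q A a b h z W) :
    ∃ p : Fin d → ℝ[X], (∀ s, vecEval p s = deriv V (aff a b s) - deriv W (aff a b s)) ∧
      IsRefMatch r k Q A (fun s => g (aff a b s) - h (aff a b s)) p ∧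
      ‖(V a - W a) - (y - z)‖ ≤ (b - a) / 2 *
        (‖vecRefInt Q (vecRefApprox A fun s => g (aff a b s) - h (aff a b s))‖
          + ‖vecRefInt Q (vecEval p)‖) := by
  obtain ⟨p, hpr, hp⟩ := hV.poly.exists_deriv_aff a b
  obtain ⟨q, hqr, hq⟩ := hW.poly.exists_deriv_aff a b
  obtain ⟨h1, h2⟩ := hV.isRefMatch hkr hab hg hpr hp
  obtain ⟨h3, h4⟩ := hW.isRefMatch hkr hab hh hqr hq
  have hτ : 0 < (b - a) / 2 := by linarith
  have hg' := contDiffOn_comp_aff hab hg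
  have hh' := contDiffOn_comp_aff hab hh
  have hev : ∀ s, vecEval (fun i => p i - q i) s = vecEval p s - vecEval q s := by
    intro s; ext i; simp
  refine ⟨fun i => p i - q i, fun s => by rw [hev, hp, hq], h1.sub h3 le_rfl hg' hh', ?_⟩
  -- For `k = 0` both jumps are given by the equations tested with `1`; for `k ≥ 1` the initial
  -- values are exact and the left-hand side vanishes.
  rcases Nat.eq_zero_or_pos k with hk | hk
  · have e1 : vecRefInt Q (vecRefApprox A fun s => g (aff a b s) - h (aff a b s))
        = vecRefInt Q (vecRefApprox A fun s => g (aff a b s))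
          - vecRefInt Q (vecRefApprox A fun s => h (aff a b s)) := by
      have hA : kA ≤ kJ k kI kA := by simp only [kJ]; lia
      rw [← vecRefInt_sub Q (contDiffOn_refApprox_comp_aff hab A hg)
        (contDiffOn_refApprox_comp_aff hab A hh)]
      exact vecRefInt_congr Q (vecRefApprox_sub A (hg'.of_le (by exact_mod_cast hA))
        (hh'.of_le (by exact_mod_cast hA)))
    have e2 : vecRefInt Q (vecEval fun i => p i - q i)
        = vecRefInt Q (vecEval p) - vecRefInt Q (vecEval q) := by
      rw [← vecRefInt_sub Q (contDiff_vecEval p).contDiffOn (contDiff_vecEval q).contDiffOn]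
      exact vecRefInt_congr Q fun s _ => hev s
    have e3 : (V a - W a) - (y - z) = ((b - a) / 2) •
        (vecRefInt Q (vecRefApprox A fun s => g (aff a b s) - h (aff a b s))
          - vecRefInt Q (vecEval fun i => p i - q i)) := by
      have : (V a - W a) - (y - z) = (V a - y) - (W a - z) := by abel
      rw [this, h2 hk, h4 hk, e1, e2, ← smul_sub]
      congr 1
      abel
    rw [e3, norm_smul, Real.norm_of_nonneg hτ.le]
    gcongr
    exact norm_sub_le _ _
  · rw [hV.init hk, hW.init hk, sub_self, norm_zero]
    positivity

/-- The triangle inequality through `𝒥u` and `u` bounds both `V - u` and `V - 𝓘^app u` by `α + S`.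
The first controls the supremum of `g`, the second its derivatives at the Hermite points; stability
of the reference problem does the rest. -/
theorem exists_local_error_bound (hkr : k ≤ r) {Q : RefIntegrator kI} {A : RefApprox kA}
    (hQ : AssUnisolvent r k Q) (hQb : AssBounded d Q) {x : Fin (K + 1) → ℝ}
    {κ : Fin (K + 1) → ℕ} (hx : ∀ m, x m ∈ Icc (-1 : ℝ) 1)
    (hP : AssPointA d kI A x κ ∨ AssPointB d Q A x κ) {X : Finset ℝ} (hX : IsExtra r k x κ X) :
    ∃ C : ℝ, 0 < C ∧ ∀ (t₀ T C₂ : ℝ) (f : ℝ → E d → E d) (u V : ℝ → E d) (y₀ : E d) (a b S α : ℝ),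
      0 < T → 0 ≤ C₂ →
      ContDiffOn ℝ (kJ k kI kA) (fun p : ℝ × E d => f p.1 p.2) (Icc t₀ (t₀ + T) ×ˢ univ) →
      AssDiff (kJ k kI kA) f t₀ T C₂ →
      (∀ t ∈ Icc t₀ (t₀ + T), HasDerivWithinAt u (f t (u t)) (Icc t₀ (t₀ + T)) t) →
      a < b → t₀ ≤ a → b ≤ t₀ + T → b - a ≤ 1 →
      IsLocalSolution r k Q A f a b y₀ V →
      (∀ s ∈ Icc a b, ‖V s - opJ r k Q A a b u s‖ ≤ S) →
      (∀ s ∈ Ioc a b, ‖u s - opApp r k x κ X a b u s‖ + ‖u s - opJ r k Q A a b u s‖ ≤ α) →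
      (∀ s ∈ Icc a b, ‖deriv V s - deriv (opJ r k Q A a b u) s‖ ≤ C * C₂ * (α + S)) ∧
      ‖(V a - opJ r k Q A a b u a) - (y₀ - u a)‖ ≤ C * C₂ * (b - a) * (α + S) := by
  have hκ : ∀ m, κ m ≤ max kI kA := by
    rcases hP with h | h
    · exact fun m => (h.1 m).trans (le_max_right _ _)
    · exact h.1
  obtain ⟨B, hB0, hB⟩ := exists_refMatch_bound hkr hQ hQb hP
  obtain ⟨B', hB'1, hB'⟩ := exists_rhs_diff_bound r k (kI := kI) (kA := kA) hx hκ hX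
  -- `B + 1` in place of `B` only ensures positivity. The two terms of the jump estimate turn the
  -- factor `(b - a) / 2` into `b - a`.
  refine ⟨(B + 1) * B', by positivity, ?_⟩
  intro t₀ T C₂ f u V y₀ a b S α hT hC₂ hf hdiff hu hab ha hb hτ hV hS hα
  have hsub : Icc a b ⊆ Icc t₀ (t₀ + T) := Icc_subset_Icc ha hb
  have hU := uniqueDiffOn_Icc (show t₀ < t₀ + T by linarith)
  have huC := contDiffOn_solution hU hf hu
  have huab := huC.mono hsub
  have hn : ((kJ k kI kA : ℕ) : WithTop ℕ∞) ≤ (kJ k kI kA + 1 : ℕ) := by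
    exact_mod_cast Nat.le_succ _
  have hfab := hf.mono (prod_mono hsub subset_rfl)
  have hgV := contDiffOn_rhs hfab (hV.poly.contDiff (n := kJ k kI kA)).contDiffOn
  have hgu := contDiffOn_rhs hfab (huab.of_le hn)
  have hJ := (isJ_opJ hkr hab hQ A huab).isStep hab (g := fun t => f t (u t)) fun t ht =>
    ((hu t (hsub ht)).mono hsub).derivWithin (uniqueDiffOn_Icc hab t ht)
  set w := opJ r k Q A a b u
  obtain ⟨p, hp, hmatch, hjump⟩ := hV.isStep.jump_sub_eq hkr hab hgV hgu hJ
  have hlip : ∀ i ≤ kJ k kI kA, ∀ s ∈ Icc a b,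
      ‖iteratedDerivWithin i (fun t => f t (V t) - f t (u t)) (Icc a b) s‖
        ≤ C₂ * ∑ l ∈ Finset.range (i + 1),
          ‖iteratedDerivWithin l (fun t => V t - u t) (Icc a b) s‖ := fun i hi s hs =>
    hdiff.forall_le hT hf hV.poly.contDiff.contDiffOn huC hab hsub hi hs
  have hVu : ∀ s ∈ Ioc a b, ‖V s - u s‖ ≤ α + S := by
    intro s hs
    have h1 := hS s (Ioc_subset_Icc_self hs)
    have h2 := hα s hs
    have h3 := norm_sub_le_norm_sub_add_norm_sub (V s) (w s) (u s)
    rw [norm_sub_rev (w s) (u s)] at h3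
    linarith [norm_nonneg (u s - opApp r k x κ X a b u s)]
  have hVu' : ∀ s ∈ Icc a b, ‖V s - u s‖ ≤ α + S := norm_le_of_forall_Ioc (g := fun s => V s - u s)
    hab (hV.poly.continuous.continuousOn.sub huab.continuousOn) hVu
  have hVA : ∀ s ∈ Ioc a b, ‖V s - opApp r k x κ X a b u s‖ ≤ α + S := by
    intro s hs
    have h1 := hS s (Ioc_subset_Icc_self hs)
    have h2 := hα s hs
    have h3 := norm_sub_le_norm_sub_add_norm_sub (V s) (w s) (opApp r k x κ X a b u s)
    have h4 := norm_sub_le_norm_sub_add_norm_sub (w s) (u s) (opApp r k x κ X a b u s)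
    rw [norm_sub_rev (w s) (u s)] at h4
    linarith
  have h0 : 0 ≤ α + S := (norm_nonneg _).trans (hVu' a (left_mem_Icc.2 hab.le))
  have h0' : 0 ≤ C₂ * (α + S) := mul_nonneg hC₂ h0
  have hcond := hB' d _ V u a b C₂ (α + S) hab hτ hC₂ (hgV.sub hgu) huab hV.poly hlip hVA
  have hsupg : ∀ s ∈ Icc (-1 : ℝ) 1, ‖f (aff a b s) (V (aff a b s)) - f (aff a b s) (u (aff a b s))‖
      ≤ B' * (C₂ * (α + S)) := by
    intro s hs
    have h := hlip 0 (Nat.zero_le _) _ (aff_mem hab hs)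
    simp only [iteratedDerivWithin_zero, zero_add, Finset.range_one, Finset.sum_singleton] at h
    have h2 := hVu' _ (aff_mem hab hs)
    have h3 : C₂ * ‖V (aff a b s) - u (aff a b s)‖ ≤ C₂ * (α + S) := by gcongr
    nlinarith
  have hψ : ContDiffOn ℝ (max kI kA : ℕ)
      (fun s => f (aff a b s) (V (aff a b s)) - f (aff a b s) (u (aff a b s))) (Icc (-1) 1) := by
    refine (contDiffOn_comp_aff hab (hgV.sub hgu)).of_le ?_
    have : max kI kA ≤ kJ k kI kA := le_max_right _ _
    exact_mod_cast this
  obtain ⟨h1, h2, h3⟩ := hB _ _ p hψ hcond hsupg hmatch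
  have hBB : B * (B' * (C₂ * (α + S))) ≤ (B + 1) * B' * C₂ * (α + S) := by
    have : 0 ≤ B' * (C₂ * (α + S)) := by positivity
    linarith
  refine ⟨fun s hs => ?_, ?_⟩
  · have h := h1 _ (affInv_mem hab hs)
    rw [hp, aff_affInv hab] at h
    exact h.trans hBB
  · refine hjump.trans ?_
    have hτ0 : 0 < (b - a) / 2 := by linarith
    calc _ ≤ (b - a) / 2 * (B * (B' * (C₂ * (α + S))) + B * (B' * (C₂ * (α + S)))) := by gcongr
      _ ≤ (b - a) / 2 * ((B + 1) * B' * C₂ * (α + S) + (B + 1) * B' * C₂ * (α + S)) := by gcongr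
      _ = _ := by ring

/-- A polynomial whose derivative and initial value are controlled by its own size is small on
short intervals. -/
theorem bounds_of_self_bound {a b c S α : ℝ} (hab : a < b) (hc : 0 ≤ c) {e e' : ℝ → E d} {z : E d}
    (he : ∀ s, HasDerivAt e (e' s) s) (hsmall : 4 * c * (b - a) ≤ 1) (hα : 0 ≤ α)
    (hS : ∀ S', (∀ s ∈ Icc a b, ‖e s‖ ≤ S') → S ≤ S') (hS0 : 0 ≤ S)
    (h1 : ∀ s ∈ Icc a b, ‖e' s‖ ≤ c * (α + S)) (h2 : ‖e a - z‖ ≤ c * (b - a) * (α + S)) :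
    S ≤ 2 * ‖z‖ + α ∧ ‖e b‖ ≤ (1 + 4 * c * (b - a)) * ‖z‖ + (b - a) * (4 * c * α) := by
  have hea : ‖e a‖ ≤ ‖z‖ + c * (b - a) * (α + S) := by
    have := norm_add_le (e a - z) z
    rw [sub_add_cancel] at this
    linarith
  -- The jump and the mean value inequality contribute `c * (b - a) * (α + S)` each.
  have hs : ∀ s ∈ Icc a b, ‖e s‖ ≤ ‖z‖ + 2 * (c * (b - a) * (α + S)) := by
    intro s hs
    have h3 := (convex_Icc a b).norm_image_sub_le_of_norm_hasDerivWithin_le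
      (fun t _ => (he t).hasDerivWithinAt) h1 (left_mem_Icc.2 hab.le) hs
    rw [Real.norm_of_nonneg (by linarith [hs.1])] at h3
    have h4 : c * (α + S) * (s - a) ≤ c * (α + S) * (b - a) := by
      have := hs.2
      gcongr
    have := norm_add_le (e s - e a) (e a)
    rw [sub_add_cancel] at this
    linarith
  have hS1 := hS _ hs
  have hba : 0 < b - a := by linarith
  -- By smallness of the interval the two contributions amount to at most half of `α + S`, so `S` is
  -- absorbed.
  have h5 : S ≤ 2 * ‖z‖ + α := by
    have : 4 * (c * (b - a) * (α + S)) ≤ α + S := by nlinarith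
    linarith
  refine ⟨h5, (hs b (right_mem_Icc.2 hab.le)).trans ?_⟩
  have : c * (b - a) * (α + S) ≤ c * (b - a) * (2 * α + 2 * ‖z‖) :=
    mul_le_mul_of_nonneg_left (by linarith) (by positivity)
  linarith

end LocalError

/-! ### The global error estimate -/

section Global

theorem IsMesh.mono {t₀ T : ℝ} {N : ℕ} {t : ℕ → ℝ} (h : IsMesh t₀ T N t) {m n : ℕ} (hmn : m ≤ n)
    (hn : n ≤ N) : t m ≤ t n := by
  induction n, hmn using Nat.le_induction with
  | base => exact le_rfl
  | succ n hmn ih =>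
    exact (ih (by lia)).trans (h.2.2 (n + 1) (Finset.mem_Icc.2 ⟨by lia, hn⟩)).le

/-- A discrete Gronwall inequality on a mesh. -/
theorem discrete_gronwall {t E : ℕ → ℝ} {c D : ℝ} (hc : 0 ≤ c) (hD : 0 ≤ D) {n : ℕ}
    (ht : ∀ m < n, t m ≤ t (m + 1)) (h0 : E 0 ≤ 0)
    (h : ∀ m < n, E (m + 1) ≤ (1 + c * (t (m + 1) - t m)) * E m + (t (m + 1) - t m) * D) :
    E n ≤ Real.exp (c * (t n - t 0)) * ((t n - t 0) * D) ∧ 0 ≤ t n - t 0 := by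
  induction n with
  | zero => simpa using h0
  | succ n ih =>
    obtain ⟨ih, h1⟩ := ih (fun m hm => ht m (by lia)) fun m hm => h m (by lia)
    have hτ : 0 ≤ t (n + 1) - t n := sub_nonneg.2 (ht n (Nat.lt_succ_self n))
    refine ⟨(h n (Nat.lt_succ_self n)).trans ?_, by linarith⟩
    set τ := t (n + 1) - t n with hτd
    have e : t (n + 1) - t 0 = (t n - t 0) + τ := by rw [hτd]; ring
    rw [e, mul_add c, Real.exp_add]
    have h2 : 1 + c * τ ≤ Real.exp (c * τ) := by
      have := Real.add_one_le_exp (c * τ)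
      linarith
    have h3 : 1 ≤ Real.exp (c * (t n - t 0)) := Real.one_le_exp (by positivity)
    have h4 : 1 ≤ Real.exp (c * τ) := Real.one_le_exp (by positivity)
    have h5 : (1 + c * τ) * E n
        ≤ Real.exp (c * τ) * (Real.exp (c * (t n - t 0)) * ((t n - t 0) * D)) :=
      (mul_le_mul_of_nonneg_left ih (by positivity)).trans
        (mul_le_mul_of_nonneg_right h2 (by positivity))
    have h6 : 1 * (τ * D) ≤ Real.exp (c * (t n - t 0)) * Real.exp (c * τ) * (τ * D) :=
      mul_le_mul_of_nonneg_right (one_le_mul_of_one_le_of_one_le h3 h4) (by positivity)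
    linarith

/-- Here `A` and `B` stand for the two maxima of the error estimate and `e` for the nodal error.
Since `4 * C + 1 ≤ M`, the exponential with `M` absorbs a factor `1 + T * C₂`; this is needed for
the derivative estimate, which is quadratic in `C₂`. The remaining `T` and `C₂` go into the
prefactor. -/
theorem final_constant_bounds {C C₂ T A B e : ℝ} (hC : 0 < C) (hC₂ : 0 ≤ C₂) (hT : 0 < T)
    (hA : 0 ≤ A) (hB : 0 ≤ B)
    (he : e ≤ Real.exp (4 * (C * C₂) * T) * (T * (4 * (C * C₂) * A + B))) :
    let M := 8 * C ^ 2 + 10 * C + 10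
    let G := M * (1 + T) * (1 + C₂) * Real.exp (M * (T * C₂))
    2 * A + 2 * e ≤ G * A + G * B ∧ A + C * C₂ * (2 * A + 2 * e) ≤ G * A + G * B := by
  intro M G
  set x := Real.exp (4 * (C * C₂) * T)
  set y := Real.exp (M * (T * C₂))
  have hx : 0 < x := Real.exp_pos _
  have hy0 : 0 < y := Real.exp_pos _
  have hTC : 0 ≤ T * C₂ := by positivity
  have hxy : x * (1 + T * C₂) ≤ y := by
    have h1 : 1 + T * C₂ ≤ Real.exp (T * C₂) := by
      have := Real.add_one_le_exp (T * C₂)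
      linarith
    refine (mul_le_mul_of_nonneg_left h1 hx.le).trans ?_
    rw [← Real.exp_add]
    refine Real.exp_le_exp.2 ?_
    simp only [M]
    nlinarith [mul_nonneg hTC (sq_nonneg C), mul_nonneg hTC hC.le]
  have hxTC : 0 ≤ x * (T * C₂) := by positivity
  have hx1 : x ≤ y := by linarith
  have hx2 : x * (T * C₂) ≤ y := by linarith
  have hy1 : 1 ≤ y := Real.one_le_exp (by positivity)
  have hG : G = M * ((1 + T + C₂ + T * C₂) * y) := by simp only [G, y]; ring
  set g := (1 + T + C₂ + T * C₂) * y
  have g1 : 1 ≤ g := by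
    have : 1 * 1 ≤ g := mul_le_mul (by linarith) hy1 zero_le_one (by positivity)
    linarith
  have g2 : C₂ ≤ g := by
    have : C₂ * 1 ≤ g := mul_le_mul (by linarith) hy1 zero_le_one (by positivity)
    linarith
  have g3 : T * x ≤ g := mul_le_mul (by linarith) hx1 hx.le (by positivity)
  have g4 : (T * C₂) * x ≤ g := mul_le_mul (by linarith) hx1 hx.le (by positivity)
  have g5 : C₂ * (x * (T * C₂)) ≤ g := mul_le_mul (by linarith) hx2 hxTC (by positivity)
  have hgA : 0 ≤ g * A := by positivity
  have hgB : 0 ≤ g * B := by positivity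
  have a1 : A ≤ g * A := le_mul_of_one_le_left hA g1
  have a2 := mul_le_mul_of_nonneg_right g2 hA
  have a4 := mul_le_mul_of_nonneg_right g4 hA
  have a5 := mul_le_mul_of_nonneg_right g5 hA
  have b3 := mul_le_mul_of_nonneg_right g3 hB
  have b4 := mul_le_mul_of_nonneg_right g4 hB
  rw [hG]
  constructor
  · have h1 : 2 * A + 2 * e ≤ 2 * A + (8 * C * (T * C₂ * x * A) + 2 * (T * x * B)) := by
      linarith
    have h2 : 8 * C * (T * C₂ * x * A) ≤ 8 * C * (g * A) :=
      mul_le_mul_of_nonneg_left a4 (by positivity)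
    have h3 : 0 ≤ C * (g * A) := by positivity
    have h4 : 0 ≤ C * (g * B) := by positivity
    have h5 : 0 ≤ C ^ 2 * (g * A) := by positivity
    have h6 : 0 ≤ C ^ 2 * (g * B) := by positivity
    simp only [M]
    linarith
  · have h0 : C * C₂ * (2 * e) ≤ C * C₂ * (2 * (x * (T * (4 * (C * C₂) * A + B)))) := by
      gcongr
    have h1 : A + C * C₂ * (2 * A + 2 * e) ≤ A + 2 * C * (C₂ * A)
        + 8 * C ^ 2 * (C₂ * (x * (T * C₂)) * A) + 2 * C * (T * C₂ * x * B) := by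
      linarith
    have h2 : 8 * C ^ 2 * (C₂ * (x * (T * C₂)) * A) ≤ 8 * C ^ 2 * (g * A) :=
      mul_le_mul_of_nonneg_left a5 (by positivity)
    have h2' : 2 * C * (T * C₂ * x * B) ≤ 2 * C * (g * B) :=
      mul_le_mul_of_nonneg_left b4 (by positivity)
    have h2'' : 2 * C * (C₂ * A) ≤ 2 * C * (g * A) :=
      mul_le_mul_of_nonneg_left a2 (by positivity)
    have h3 : 0 ≤ C * (g * A) := by positivity
    have h4 : 0 ≤ C * (g * B) := by positivity
    have h6 : 0 ≤ C ^ 2 * (g * B) := by positivity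
    simp only [M]
    linarith

end Global

end VTD

end

/-! ### The error estimate -/

theorem mainTheorem2 (d r k kI kA : ℕ) (hkr : k ≤ r)
    (Q : VTD.RefIntegrator kI) (A : VTD.RefApprox kA)
    (hQ : VTD.AssUnisolvent r k Q) (hQb : VTD.AssBounded d Q)
    (K : ℕ) (x : Fin (K + 1) → ℝ) (κ : Fin (K + 1) → ℕ)
    (hx : ∀ m, x m ∈ Set.Icc (-1 : ℝ) 1) (hxinj : Function.Injective x)
    (hP : VTD.AssPointA d kI A x κ ∨ VTD.AssPointB d Q A x κ)
    (X : Finset ℝ) (hX : VTD.IsExtra r k x κ X) :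
    -- `M` depends on the reference data only, not on `T`, `C₂`, `f`, `u` or the mesh
    ∃ M : ℝ, 0 < M ∧
      ∀ (t₀ T C₂ : ℝ) (f : ℝ → VTD.E d → VTD.E d) (u₀ : VTD.E d) (u : ℝ → VTD.E d)
        (N : ℕ) (t : ℕ → ℝ) (U : ℕ → ℝ → VTD.E d),
        0 < T → 0 ≤ C₂ →
        ContDiffOn ℝ (VTD.kJ k kI kA) (fun p : ℝ × VTD.E d => f p.1 p.2)
          (Set.Icc t₀ (t₀ + T) ×ˢ Set.univ) →
        VTD.AssDiff (VTD.kJ k kI kA) f t₀ T C₂ →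
        VTD.IsIVPSolution f t₀ T u₀ u →
        VTD.IsMesh t₀ T N t →
        (∀ n ∈ Finset.Icc 1 N, t n - t (n - 1) ≤ 1) →
        -- the mesh size is sufficiently small
        (∀ n ∈ Finset.Icc 1 N, M * C₂ * (t n - t (n - 1)) ≤ 1) →
        VTD.IsDiscreteSolution r k Q A f u₀ N t U →
        ∀ n ∈ Finset.Icc 1 N, ∀ l ≤ 1, ∀ s ∈ Set.Ioc (t (n - 1)) (t n),
          ‖iteratedDerivWithin l (fun y => u y - U n y) (Set.Icc (t (n - 1)) (t n)) s‖
            ≤ M * (1 + T) * (1 + C₂) * Real.exp (M * (T * C₂)) *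
                (⨆ ν : Finset.Icc 1 n,
                  (VTD.supNorm (Set.Ioc (t (ν - 1)) (t ν))
                      (fun y => u y - VTD.opApp r k x κ X (t (ν - 1)) (t ν) u y)
                    + ∑ j ∈ Finset.range (l + 1),
                      VTD.supNorm (Set.Ioc (t (ν - 1)) (t ν))
                        (iteratedDerivWithin j
                          (fun y => u y - VTD.opJ r k Q A (t (ν - 1)) (t ν) u y)
                          (Set.Icc (t (ν - 1)) (t ν)))))
              + M * (1 + T) * (1 + C₂) * Real.exp (M * (T * C₂)) *
                (⨆ ν : Finset.Icc 1 (n - 1),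
                  (t ν - t (ν - 1))⁻¹ *
                    ‖u (t ν) - VTD.opJ r k Q A (t (ν - 1)) (t ν) u (t ν)‖) := by
  obtain ⟨C, hC, hloc⟩ := VTD.exists_local_error_bound hkr hQ hQb hx hP hX
  -- The constant of `final_constant_bounds`; being at least `4 * C`, it also yields the smallness
  -- required for absorption on each cell.
  refine ⟨8 * C ^ 2 + 10 * C + 10, by positivity, ?_⟩
  intro t₀ T C₂ f u₀ u N t U hT hC₂ hf hdiff hu hmesh hτ1 hsmall hU n hn l hl s hs
  obtain ⟨hn1, hnN⟩ := Finset.mem_Icc.1 hn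
  set α : ℝ := ⨆ ν : Finset.Icc 1 n, (VTD.supNorm (Set.Ioc (t (ν - 1)) (t ν))
    (fun y => u y - VTD.opApp r k x κ X (t (ν - 1)) (t ν) u y) + ∑ j ∈ Finset.range (l + 1),
      VTD.supNorm (Set.Ioc (t (ν - 1)) (t ν)) (iteratedDerivWithin j
        (fun y => u y - VTD.opJ r k Q A (t (ν - 1)) (t ν) u y) (Set.Icc (t (ν - 1)) (t ν))))

  -- For `n = 1` the index set is empty and the real supremum is `0`.
  set β : ℝ := ⨆ ν : Finset.Icc 1 (n - 1), (t ν - t (ν - 1))⁻¹ *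
    ‖u (t ν) - VTD.opJ r k Q A (t (ν - 1)) (t ν) u (t ν)‖
  have hα0 : 0 ≤ α := Real.iSup_nonneg fun ν => add_nonneg (VTD.supNorm_nonneg _ _)
    (Finset.sum_nonneg fun _ _ => VTD.supNorm_nonneg _ _)
  have hcell : ∀ ν ∈ Finset.Icc 1 N, t (ν - 1) < t ν ∧ t₀ ≤ t (ν - 1) ∧ t ν ≤ t₀ + T := by
    intro ν hν
    obtain ⟨h1, h2⟩ := Finset.mem_Icc.1 hν
    refine ⟨hmesh.2.2 ν hν, ?_, ?_⟩
    · rw [← hmesh.1]; exact hmesh.mono (Nat.zero_le _) (by lia)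
    · rw [← hmesh.2.1]; exact hmesh.mono h2 le_rfl
  have hβ0 : 0 ≤ β := Real.iSup_nonneg fun ν => by
    obtain ⟨h1, h2⟩ := Finset.mem_Icc.1 ν.2
    have := (hcell ν (Finset.mem_Icc.2 ⟨h1, by lia⟩)).1
    exact mul_nonneg (inv_nonneg.2 (sub_nonneg.2 this.le)) (norm_nonneg _)
  have huC := VTD.contDiffOn_solution (uniqueDiffOn_Icc (show t₀ < t₀ + T by linarith)) hf hu.2
  have huν : ∀ ν ∈ Finset.Icc 1 N, ContDiffOn ℝ (VTD.kJ k kI kA + 1 : ℕ) u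
      (Set.Icc (t (ν - 1)) (t ν)) := fun ν hν =>
    huC.mono (Set.Icc_subset_Icc (hcell ν hν).2.1 (hcell ν hν).2.2)
  have hJ : ∀ ν ∈ Finset.Icc 1 N,
      VTD.IsVecPoly r (VTD.opJ r k Q A (t (ν - 1)) (t ν) u) := fun ν hν =>
    (VTD.isJ_opJ hkr (hcell ν hν).1 hQ A (huν ν hν)).poly
  have hη : ∀ ν ∈ Finset.Icc 1 N, ContDiffOn ℝ 1
      (fun y => u y - VTD.opJ r k Q A (t (ν - 1)) (t ν) u y) (Set.Icc (t (ν - 1)) (t ν)) :=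
    fun ν hν => ((huν ν hν).of_le (by exact_mod_cast Nat.le_add_left 1 _)).sub
      (hJ ν hν).contDiff.contDiffOn
  have hαν : ∀ ν ∈ Finset.Icc 1 n, VTD.supNorm (Set.Ioc (t (ν - 1)) (t ν))
      (fun y => u y - VTD.opApp r k x κ X (t (ν - 1)) (t ν) u y) + ∑ j ∈ Finset.range (l + 1),
        VTD.supNorm (Set.Ioc (t (ν - 1)) (t ν)) (iteratedDerivWithin j
          (fun y => u y - VTD.opJ r k Q A (t (ν - 1)) (t ν) u y) (Set.Icc (t (ν - 1)) (t ν)))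
      ≤ α := fun ν hν => le_ciSup (f := fun ν : Finset.Icc 1 n =>
        VTD.supNorm (Set.Ioc (t (ν - 1)) (t ν))
          (fun y => u y - VTD.opApp r k x κ X (t (ν - 1)) (t ν) u y) + ∑ j ∈ Finset.range (l + 1),
          VTD.supNorm (Set.Ioc (t (ν - 1)) (t ν)) (iteratedDerivWithin j
            (fun y => u y - VTD.opJ r k Q A (t (ν - 1)) (t ν) u y) (Set.Icc (t (ν - 1)) (t ν))))
      (Set.finite_range _).bddAbove ⟨ν, hν⟩
  have hα : ∀ ν ∈ Finset.Icc 1 n, ∀ s ∈ Set.Ioc (t (ν - 1)) (t ν),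
      ‖u s - VTD.opApp r k x κ X (t (ν - 1)) (t ν) u s‖
        + ‖u s - VTD.opJ r k Q A (t (ν - 1)) (t ν) u s‖ ≤ α := by
    intro ν hν s hs
    obtain ⟨h1, h2⟩ := Finset.mem_Icc.1 hν
    have hνN : ν ∈ Finset.Icc 1 N := Finset.mem_Icc.2 ⟨h1, by lia⟩
    refine le_trans (add_le_add ?_ ?_) (hαν ν hν)
    · exact VTD.norm_le_supNorm_Ioc ((huν ν hνN).continuousOn.sub
        (VTD.exists_isApp hX (hcell ν hνN).1 u).1.continuous.continuousOn) hs
    · refine le_trans ?_ (Finset.single_le_sum (f := fun j =>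
        VTD.supNorm (Set.Ioc (t (ν - 1)) (t ν)) (iteratedDerivWithin j
          (fun y => u y - VTD.opJ r k Q A (t (ν - 1)) (t ν) u y) (Set.Icc (t (ν - 1)) (t ν))))
        (fun _ _ => VTD.supNorm_nonneg _ _) (Finset.mem_range.2 (Nat.succ_pos l)))
      simp only [iteratedDerivWithin_zero]
      exact VTD.norm_le_supNorm_Ioc (hη ν hνN).continuousOn hs
  let y₀ : ℕ → VTD.E d := fun ν => if ν = 1 then u₀ else U (ν - 1) (t (ν - 1))
  have hlocal : ∀ ν ∈ Finset.Icc 1 n,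
      (∀ s ∈ Set.Icc (t (ν - 1)) (t ν), ‖U ν s - VTD.opJ r k Q A (t (ν - 1)) (t ν) u s‖
        ≤ 2 * ‖y₀ ν - u (t (ν - 1))‖ + α) ∧
      (∀ s ∈ Set.Icc (t (ν - 1)) (t ν),
        ‖deriv (U ν) s - deriv (VTD.opJ r k Q A (t (ν - 1)) (t ν) u) s‖
          ≤ C * C₂ * (2 * α + 2 * ‖y₀ ν - u (t (ν - 1))‖)) ∧
      ‖U ν (t ν) - VTD.opJ r k Q A (t (ν - 1)) (t ν) u (t ν)‖
        ≤ (1 + 4 * (C * C₂) * (t ν - t (ν - 1))) * ‖y₀ ν - u (t (ν - 1))‖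
          + (t ν - t (ν - 1)) * (4 * (C * C₂) * α) := by
    intro ν hν
    obtain ⟨h1, h2⟩ := Finset.mem_Icc.1 hν
    have hνN : ν ∈ Finset.Icc 1 N := Finset.mem_Icc.2 ⟨h1, by lia⟩
    obtain ⟨hab, ha, hb⟩ := hcell ν hνN
    have hUν := hU ν hνN
    have hsm : 4 * (C * C₂) * (t ν - t (ν - 1)) ≤ 1 := by
      refine le_trans ?_ (hsmall ν hνN)
      have : 0 ≤ C₂ * (t ν - t (ν - 1)) := mul_nonneg hC₂ (sub_nonneg.2 hab.le)
      nlinarith [mul_nonneg this hC.le, mul_nonneg this (sq_nonneg C)]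
    set w := VTD.opJ r k Q A (t (ν - 1)) (t ν) u
    have hec : ContinuousOn (fun s => U ν s - w s) (Set.Icc (t (ν - 1)) (t ν)) :=
      (hUν.poly.continuous.sub (hJ ν hνN).continuous).continuousOn
    have hS := fun s hs => VTD.norm_le_supNorm_Icc hab hec (t := s) hs
    set S := VTD.supNorm (Set.Ioc (t (ν - 1)) (t ν)) (fun s => U ν s - w s)
    obtain ⟨hd, hj⟩ := hloc t₀ T C₂ f u (U ν) (y₀ ν) _ _ S α hT hC₂ hf hdiff hu.2 hab ha hb
      (hτ1 ν hνN) hUν hS (hα ν hν)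
    have hder : ∀ s, HasDerivAt (fun s => U ν s - w s) (deriv (U ν) s - deriv w s) s := fun s =>
      (hUν.poly.differentiable s).hasDerivAt.sub
        ((hJ ν hνN).differentiable s).hasDerivAt
    obtain ⟨h3, h4⟩ := VTD.bounds_of_self_bound (c := C * C₂) (S := S) hab (by positivity) hder hsm
      hα0 (fun S' hS' => VTD.supNorm_le (Set.nonempty_Ioc.2 hab)
        fun t ht => hS' t (Set.Ioc_subset_Icc_self ht)) (VTD.supNorm_nonneg _ _) hd hj
    refine ⟨fun s hs => (hS s hs).trans h3, fun s hs => (hd s hs).trans ?_, h4⟩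
    exact mul_le_mul_of_nonneg_left (by linarith) (by positivity)
  have hβ : ∀ ν ∈ Finset.Icc 1 (n - 1),
      ‖u (t ν) - VTD.opJ r k Q A (t (ν - 1)) (t ν) u (t ν)‖ ≤ (t ν - t (ν - 1)) * β := by
    intro ν hν
    obtain ⟨h1, h2⟩ := Finset.mem_Icc.1 hν
    have hab := sub_pos.2 (hcell ν (Finset.mem_Icc.2 ⟨h1, by lia⟩)).1
    have h := le_ciSup (f := fun ν : Finset.Icc 1 (n - 1) => (t ν - t (ν - 1))⁻¹ *
      ‖u (t ν) - VTD.opJ r k Q A (t (ν - 1)) (t ν) u (t ν)‖)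
      (Set.finite_range _).bddAbove ⟨ν, hν⟩
    exact (inv_mul_le_iff₀ hab).1 h
  have hE : ‖y₀ n - u (t (n - 1))‖
      ≤ Real.exp (4 * (C * C₂) * T) * (T * (4 * (C * C₂) * α + β)) := by
    have hD : 0 ≤ 4 * (C * C₂) * α + β := by positivity
    -- The error at `t m` is that of the value entering cell `m + 1`; it vanishes for `m = 0`. Only
    -- `n - 1` steps are taken, so `β` need not include cell `n`.
    obtain ⟨hg, hg0⟩ := VTD.discrete_gronwall (t := t)
      (E := fun m => ‖y₀ (m + 1) - u (t m)‖) (c := 4 * (C * C₂))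
      (D := 4 * (C * C₂) * α + β) (by positivity) hD (n := n - 1)
      (fun m hm => hmesh.mono (Nat.le_succ m) (by lia))
      (by simp [y₀, hmesh.1, hu.1])
      (fun m hm => by
        have h1 := (hlocal (m + 1) (Finset.mem_Icc.2 ⟨by lia, by lia⟩)).2.2
        have h2 := hβ (m + 1) (Finset.mem_Icc.2 ⟨by lia, by lia⟩)
        simp only [Nat.add_sub_cancel] at h1 h2
        have h3 : y₀ (m + 1 + 1) = U (m + 1) (t (m + 1)) := by simp [y₀]
        rw [h3]
        have h4 := norm_sub_le_norm_sub_add_norm_sub (U (m + 1) (t (m + 1)))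
          (VTD.opJ r k Q A (t m) (t (m + 1)) u (t (m + 1))) (u (t (m + 1)))
        rw [norm_sub_rev (VTD.opJ r k Q A (t m) (t (m + 1)) u (t (m + 1)))] at h4
        linarith)
    simp only [Nat.sub_add_cancel hn1] at hg
    have hTn : t (n - 1) - t 0 ≤ T := by
      have := (hcell n hn)
      rw [hmesh.1]
      linarith
    refine hg.trans ?_
    gcongr
  obtain ⟨hfin0, hfin1⟩ := VTD.final_constant_bounds hC hC₂ hT hα0 hβ0 hE
  have hnn : n ∈ Finset.Icc 1 n := Finset.mem_Icc.2 ⟨hn1, le_rfl⟩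
  obtain ⟨hab, -, -⟩ := hcell n hn
  obtain ⟨he, hed, -⟩ := hlocal n hnn
  have hsI := Set.Ioc_subset_Icc_self hs
  have hUn := (hU n hn).poly
  have hJn := hJ n hn
  have hηn := hη n hn
  set w := VTD.opJ r k Q A (t (n - 1)) (t n) u
  -- In both cases `u - U` is split at `𝒥u`. Only for `l = 1` does `α` contain the derivative of `u
  -- - 𝒥u`.
  obtain rfl | rfl : l = 0 ∨ l = 1 := by lia
  · refine le_trans ?_ hfin0
    rw [iteratedDerivWithin_zero]
    have h1 := he s hsI
    have h2 := hα n hnn s hs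
    have h3 := norm_sub_le_norm_sub_add_norm_sub (u s) (w s) (U n s)
    rw [norm_sub_rev (w s) (U n s)] at h3
    linarith [norm_nonneg (u s - VTD.opApp r k x κ X (t (n - 1)) (t n) u s)]
  · refine le_trans ?_ hfin1
    have hdU := ((hUn.differentiable s).hasDerivAt.sub
      (hJn.differentiable s).hasDerivAt).hasDerivWithinAt
      (s := Set.Icc (t (n - 1)) (t n))
    have hdη := (hηn.differentiableOn one_ne_zero s hsI).hasDerivWithinAt
    have h1 : iteratedDerivWithin 1 (fun y => u y - U n y) (Set.Icc (t (n - 1)) (t n)) s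
        = iteratedDerivWithin 1 (fun y => u y - w y) (Set.Icc (t (n - 1)) (t n)) s
          - (deriv (U n) s - deriv w s) := by
      rw [iteratedDerivWithin_one, iteratedDerivWithin_one]
      have h := (hdη.sub hdU).derivWithin (uniqueDiffOn_Icc hab s hsI)
      rw [← h]
      congr 1
      ext1 y
      simp
    rw [h1]
    have h2 := VTD.norm_le_supNorm_Ioc (hηn.continuousOn_iteratedDerivWithin (m := 1) le_rfl
      (uniqueDiffOn_Icc hab)) hs
    have h3 := hαν n hnn
    rw [Finset.sum_range_succ, Finset.sum_range_one] at h3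
    have h4 := VTD.supNorm_nonneg (Set.Ioc (t (n - 1)) (t n))
      (fun y => u y - VTD.opApp r k x κ X (t (n - 1)) (t n) u y)
    have h5 := VTD.supNorm_nonneg (Set.Ioc (t (n - 1)) (t n))
      (iteratedDerivWithin 0 (fun y => u y - w y) (Set.Icc (t (n - 1)) (t n)))
    refine (norm_sub_le _ _).trans (add_le_add ?_ (hed s hsI))
    linarith
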